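/- **Model.** Let $G$ be a finite simple undirected graph with $n$ vertices and $m\ge 1$ edges. Its vertices are labelled arbitrarily by $[n]$, and for every vertex $v$ the neighbors of $v$ are labelled arbitrarily by $[d(v)]$, where $d(v)$ is the degree of $v$. A randomized algorithm knows $n$ and may ask three kinds of queries: given $i\in[n]$, the $i$-th vertex; given a vertex $v$, its degree $d(v)$; given a vertex $v$ and $j\in[d(v)]$, the $j$-th neighbor of $v$. The expected query complexity is the expected number of queries in a run. A uniformly random neighbor of $v$ is obtained by asking for $d(v)$ and then for the $j$-th neighbor, $j$ uniform in $[d(v)]$. **Bernoulli factory.** Call $F$ a factory for $1/(2p)$ if $F$ is a randomized algorithm, not depending on $p$, that may use its own randomness and independent $\mathrm{Bern}(p)$ trials and such that, for every $p\in[2/3,1]$, it outputs a bit with distribution $\mathrm{Bern}(1/(2p))$ and uses an expected number of trials bounded by a constant not depending on $p$. **Algorithm.** The input is a number $\tilde m$ (an estimate of $m$); put $\theta=\lceil\sqrt{6\tilde m}\,\rceil$. A vertex is *light* if its degree is at most $\theta$, and *heavy* otherwise. *Attempt:* Draw a uniformly random vertex $u$ and a uniform $j\in[\theta]$. Fail if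 $d(u)>\theta$ or $j>d(u)$. Otherwise let $v$ be the $j$-th neighbor of $u$, and draw $B\sim\mathrm{Bern}(1/3)$. If $B=1$, return $uv$. If $B=0$ and $v$ is heavy, return $vw$ for a uniformly random neighbor $w$ of $v$. Otherwise fail. *Sampling algorithm:* Repeat the following. Make an attempt; if it returns $vw$ with $v$ light, return $vw$. If it returns $vw$ with $v$ heavy, run $F$ on the trials "a fresh uniformly random neighbor of $v$ is light", and return $vw$ if $F$ outputs $1$. In all other cases, go on with the next repetition. **Theorem.** A factory $F$ for $1/(2p)$ exists. Moreover, for every such factory $F$ and every $a\in\mathbb R$ there is a constant $C$, depending only on $F$ and $a$, such that for every graph $G$ with $m\ge1$ edges, every labelling of its vertices and neighbors, and every real $\tilde m$ with $m\le\tilde m\le a\,m$ (for instance $\tilde m=m$, when $a\ge 1$), the sampling algorithm on $G$ with input $\tilde m$ has the following properties. 1. It returns a perfectly uniform edge: each edge of $G$ is returned with probability exactly $1/m$. More precisely, each ordered pair $(u,v)$ of adjacent vertices is returned with probability exactly $1/(2m)$, and every other pair with probability $0$. 2. Its expected query complexity is at most $C\,n/\sqrt m$. -/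

import Mathlib

open scoped ENNReal

noncomputable section

/-- Randomized algorithms with oracle access and output in `α`. A query `q : Q` is answered by an
element of `A q`. An algorithm returns a value, draws from a distribution of its own, makes a
query, or runs a loop: starting in the state `s`, the loop body is run until it returns some
`Sum.inr b`; a result `Sum.inl s'` means another round from state `s'`. -/
inductive Prog (Q : Type) (A : Q → Type) : Type → Type 1
  | ret {α : Type} (a : α) : Prog Q A α
  | rand {α β : Type} (μ : PMF β) (k : β → Prog Q A α) : Prog Q A α
  | query {α : Type} (q : Q) (k : A q → Prog Q A α) : Prog Q A α
  | loop {α σ β : Type} (body : σ → Prog Q A (σ ⊕ β)) (s : σ) (k : β → Prog Q A α) : Prog Q A α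

namespace Prog

variable {Q : Type} {A : Q → Type}

/-- Sequential composition. -/
def bind {α β : Type} (P : Prog Q A α) (g : α → Prog Q A β) : Prog Q A β :=
  match P with
  | ret a => g a
  | rand μ k => rand μ (fun b => (k b).bind g)
  | query q k => query q (fun r => (k r).bind g)
  | loop body s k => loop body s (fun b => (k b).bind g)

instance : Monad (Prog Q A) where
  pure := ret
  bind := bind

/-- Draw from the distribution `μ`, using internal randomness. -/
def sample {β : Type} (μ : PMF β) : Prog Q A β := rand μ ret

/-- Make the query `q` and return the answer. -/
def ask (q : Q) : Prog Q A (A q) := query q ret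

/-- Run `P` again and again until it returns `some a`; then return `a`. -/
def repeatUntil {α : Type} (P : Prog Q A (Option α)) : Prog Q A α :=
  loop (fun _ : Unit => P.bind fun r =>
    match r with
    | none => ret (Sum.inl ())
    | some a => ret (Sum.inr a)) () ret

/-- Run `P`, answering each query `q` of `P` by a fresh run of the subroutine `g q`. -/
def substQuery {Q' : Type} {A' : Q' → Type} {α : Type} (g : ∀ q, Prog Q' A' (A q))
    (P : Prog Q A α) : Prog Q' A' α :=
  match P with
  | ret a => ret a
  | rand μ k => rand μ (fun b => (k b).substQuery g)
  | query q k => (g q).bind (fun r => (k r).substQuery g)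
  | loop body s k =>
      loop (fun s' => (body s').substQuery g) s (fun b => (k b).substQuery g)

/-- `ev O c P f` is the expected value of `c * (number of queries made) + f (output)` in a run of
`P`, where each query `q` is answered by an independent draw from `O q` and where the term
`f (output)` counts as `0` if the run does not halt. The value of a loop is the limit of the values
of its truncations to at most `N` rounds (a truncated run counts as not halting). -/
def ev (O : ∀ q, PMF (A q)) (c : ℝ≥0∞) {α : Type} (P : Prog Q A α) (f : α → ℝ≥0∞) : ℝ≥0∞ :=
  match P with
  | ret a => f a
  | rand μ k => ∑' b, μ b * ev O c (k b) f
  | query q k => c + ∑' r, O q r * ev O c (k r) f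
  | loop body s k =>
      ⨆ N : ℕ, (fun X s' => ev O c (body s') (Sum.elim X (fun b => ev O c (k b) f)))^[N]
        (fun _ => 0) s

/-- The probability that `P` halts with an output in `S`. -/
def prob (O : ∀ q, PMF (A q)) {α : Type} (P : Prog Q A α) (S : Set α) : ℝ≥0∞ :=
  ev O 0 P (S.indicator 1)

/-- The expected number of queries that `P` makes (over the whole run, halting or not). -/
def expectedQueries (O : ∀ q, PMF (A q)) {α : Type} (P : Prog Q A α) : ℝ≥0∞ :=
  ev O 1 P 0

end Prog

/-- A uniformly random element of `{0, …, k - 1}` (and `0` if `k = 0`). -/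
def uniformBelow (k : ℕ) : PMF ℕ :=
  if h : 0 < k then PMF.uniformOfFinset (Finset.range k) ⟨0, Finset.mem_range.mpr h⟩
  else PMF.pure 0

/-- The distribution `Bern(p)` on bits: `true` has probability `p`. -/
def bern (p : NNReal) (hp : p ≤ 1) : PMF Bool :=
  PMF.ofFintype (fun b => if b = true then (p : ℝ≥0∞) else 1 - (p : ℝ≥0∞)) <| by
    have h : (p : ℝ≥0∞) ≤ 1 := by exact_mod_cast hp
    simp [add_tsub_cancel_of_le h]

theorem one_third_le_one : (1 / 3 : NNReal) ≤ 1 := by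
  rw [div_le_one (by norm_num)]
  norm_num

/-- Algorithms with access to a coin and with output a bit: the only query is a coin flip. -/
abbrev CoinProg : Type 1 := Prog Unit (fun _ => Bool) Bool

/-- The coin that shows `true` with probability `p`; its flips are independent. -/
def coin (p : NNReal) (hp : p ≤ 1) : Unit → PMF Bool := fun _ => bern p hp

/-- `F` is a Bernoulli factory for `p ↦ 1 / (2 p)` on `[2/3, 1]`: it does not know `p`, it flips a
`Bern(p)` coin a number of times with expectation bounded uniformly in `p`, and it
outputs a bit with distribution `Bern(1 / (2 p))`. -/
def IsInvTwoFactory (F : CoinProg) : Prop :=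
  (∀ (p : NNReal) (hp : p ≤ 1), 2 / 3 ≤ p →
    F.prob (coin p hp) {true} = ENNReal.ofReal (1 / (2 * (p : ℝ))) ∧
    F.prob (coin p hp) {false} = ENNReal.ofReal (1 - 1 / (2 * (p : ℝ)))) ∧
  ∃ K : NNReal, ∀ (p : NNReal) (hp : p ≤ 1), 2 / 3 ≤ p →
    F.expectedQueries (coin p hp) ≤ K

/-- The queries of the indexed neighbor access model (labels are counted from `0`). -/
inductive GraphQuery (V : Type) : Type
  | vertex (i : ℕ)
  | degree (v : V)
  | neighbor (v : V) (j : ℕ)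

/-- The type of answers; the answer `none` is given for a label out of range. -/
def GraphQuery.Ans {V : Type} : GraphQuery V → Type
  | .vertex _ => Option V
  | .degree _ => ℕ
  | .neighbor _ _ => Option V

/-- Algorithms with query access to a graph on the vertex set `V`. -/
abbrev GraphProg (V : Type) : Type → Type 1 := Prog (GraphQuery V) GraphQuery.Ans

/-- Arbitrary labellings of the vertices of `G` by `n` labels, and of the edges at each vertex `v`
(that is, of the neighbors of `v`) by `d(v)` labels. -/
structure IndexedAccess {V : Type} [Fintype V] (G : SimpleGraph V) [DecidableRel G.Adj] where
  vertexLabel : Fin (Fintype.card V) ≃ V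
  neighborLabel : ∀ v : V, Fin (G.degree v) ≃ G.neighborSet v

/-- The answers to the queries about `G`. -/
def IndexedAccess.answer {V : Type} [Fintype V] {G : SimpleGraph V} [DecidableRel G.Adj]
    (L : IndexedAccess G) : ∀ q : GraphQuery V, q.Ans
  | .vertex i => if h : i < Fintype.card V then some (L.vertexLabel ⟨i, h⟩) else none
  | .degree v => G.degree v
  | .neighbor v j => if h : j < G.degree v then some (L.neighborLabel v ⟨j, h⟩ : V) else none

/-- The (deterministic) oracle for `G`. -/
def IndexedAccess.oracle {V : Type} [Fintype V] {G : SimpleGraph V} [DecidableRel G.Adj]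
    (L : IndexedAccess G) (q : GraphQuery V) : PMF q.Ans := PMF.pure (L.answer q)

section Algorithms

variable {V : Type}

def askVertex (i : ℕ) : GraphProg V (Option V) := Prog.ask (GraphQuery.vertex i)

def askDegree (v : V) : GraphProg V ℕ := Prog.ask (GraphQuery.degree v)

def askNeighbor (v : V) (j : ℕ) : GraphProg V (Option V) := Prog.ask (GraphQuery.neighbor v j)

/-- A uniformly random neighbor of `v` (`none` only if `v` is isolated). -/
def randomNeighbor (v : V) : GraphProg V (Option V) := do
  let d ← askDegree v
  let j ← Prog.sample (uniformBelow d)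
  askNeighbor v j

/-- One attempt at sampling an edge in a graph on `n` vertices, with degree threshold `θ`: a vertex
is light if its degree is at most `θ` and heavy otherwise. The result `none` means failure.
(The branches for `none` answers of the oracle are never taken.) -/
def tryEdge (n θ : ℕ) : GraphProg V (Option (V × V)) := do
  let i ← Prog.sample (uniformBelow n)
  let some u ← askVertex i | return none
  let j ← Prog.sample (uniformBelow θ)
  let d ← askDegree u
  if d > θ ∨ d ≤ j then
    return none
  else
    let some v ← askNeighbor u j | return none
    let B ← Prog.sample (bern (1 / 3) one_third_le_one)
    if B = true then
      return some (u, v)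
    else
      let d' ← askDegree v
      if d' > θ then
        let some w ← randomNeighbor v | return none
        return some (v, w)
      else
        return none

/-- The trial whether a uniformly random neighbor of `v` is light. -/
def lightNeighborTrial (θ : ℕ) (v : V) : GraphProg V Bool := do
  let some w ← randomNeighbor v | return false
  let d ← askDegree w
  return decide (d ≤ θ)

/-- One round: attempt to sample an edge `vw`. If `v` is light, keep the edge. If `v` is heavy, run
the Bernoulli factory `F` on the trials whether a random neighbor of `v` is light, and keep the
edge if and only if the outcome of `F` is `true`. -/
def edgeRound (F : CoinProg) (n θ : ℕ) : GraphProg V (Option (V × V)) := do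
  let some (v, w) ← tryEdge n θ | return none
  let d ← askDegree v
  if d ≤ θ then
    return some (v, w)
  else
    let Y ← Prog.substQuery (fun _ => lightNeighborTrial θ v) F
    if Y = true then
      return some (v, w)
    else
      return none

/-- The edge sampling algorithm for a graph on `n` vertices, given the estimate `mt` of the number
of edges: repeat rounds with threshold `⌈√(6 mt)⌉` until one of them returns an edge. -/
def sampleEdge (F : CoinProg) (n : ℕ) (mt : ℝ) : GraphProg V (V × V) :=
  Prog.repeatUntil (edgeRound F n ⌈√(6 * mt)⌉₊)

end Algorithms

end

/-! In one round every ordered pair of adjacent vertices is returned with the same probability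
1/(3nθ). If `u` is light, `uv` arises only by drawing `u`, the label of `v` and B = 1. If `v` is
heavy and a fraction p of its neighbors is light, the draw arrives at `v` from a light vertex with
probability p·d(v)/(nθ); B = 0 and the choice of `w` turn this into 2p/(3nθ), and the factor 1/(2p)
of the factory removes p (`lightFraction_mul_keepProb`, `ev_edgeRound`). The factory applies because
p ≥ 2/3: too many heavy neighbors would have total degree above 2m (`two_thirds_le_lightFraction`).
So a round succeeds with probability 2m/(3nθ) at bounded expected cost, and repetition
(`Prog.ev_repeatUntil`, `Prog.ev_repeatUntil_le`) gives uniformity and O(nθ/m) = O(n/√m) queries.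

For the factory, put q = 1 - p. Then 1/(2p) = Σ 2^{-(i+1)} (2q)^i, so it suffices to draw i
geometrically and then a bit of bias (2q)^i. A random walk on heights, with output `true` at 0, has
(cq)^i as a harmonic function. It drifts upwards, so at a barrier it stops with `false` unless a
coin of bias (c/c')^i lets it go on with a larger c'; harmonicity survives since (c/c')^i (c'q)^i =
(cq)^i. The multipliers stay below 5/2, hence cq ≤ 5/6, and a potential bounds the expected number
of rounds.

Loops are handled through `Prog.ev_loop_le`: any supersolution is an upper bound. Upper bounds for
complementary events, together with almost sure halting, give exact values. -/

open scoped ENNReal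

/-! ### Calculus of expected values of programs -/

namespace Prog

variable {Q : Type} {A : Q → Type} (O : ∀ q, PMF (A q))

theorem ev_ret (c : ℝ≥0∞) {α : Type} (a : α) (f : α → ℝ≥0∞) :
    ev O c (ret a) f = f a := by simp only [ev]

theorem ev_rand (c : ℝ≥0∞) {α β : Type} (μ : PMF β) (k : β → Prog Q A α) (f : α → ℝ≥0∞) :
    ev O c (rand μ k) f = ∑' b, μ b * ev O c (k b) f := by simp only [ev]

theorem ev_query (c : ℝ≥0∞) {α : Type} (q : Q) (k : A q → Prog Q A α) (f : α → ℝ≥0∞) :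
    ev O c (query q k) f = c + ∑' r, O q r * ev O c (k r) f := by simp only [ev]

theorem ev_sample (c : ℝ≥0∞) {β : Type} (μ : PMF β) (f : β → ℝ≥0∞) :
    ev O c (sample μ) f = ∑' b, μ b * f b := by simp only [sample, ev]

theorem ev_ask (c : ℝ≥0∞) (q : Q) (f : A q → ℝ≥0∞) :
    ev O c (ask q) f = c + ∑' r, O q r * f r := by simp only [ask, ev]

/-- The expected value of one round of a loop, as a function of the values `X` of the states after
that round and the values `h` of the results of the loop. -/
noncomputable def loopStep (c : ℝ≥0∞) {σ β : Type} (body : σ → Prog Q A (σ ⊕ β)) (h : β → ℝ≥0∞)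
    (X : σ → ℝ≥0∞) (s : σ) : ℝ≥0∞ :=
  ev O c (body s) (Sum.elim X h)

theorem ev_loop (c : ℝ≥0∞) {α σ β : Type} (body : σ → Prog Q A (σ ⊕ β)) (s : σ)
    (k : β → Prog Q A α) (f : α → ℝ≥0∞) :
    ev O c (loop body s k) f =
      ⨆ N : ℕ, (loopStep O c body fun b => ev O c (k b) f)^[N] (fun _ => 0) s := by
  rw [ev]; rfl

theorem ev_bind (c : ℝ≥0∞) {α β : Type} (P : Prog Q A α) (g : α → Prog Q A β) (f : β → ℝ≥0∞) :
    ev O c (P.bind g) f = ev O c P fun a => ev O c (g a) f := by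
  induction P with
  | ret a => simp only [Prog.bind, ev]
  | rand μ k ih => simp only [Prog.bind, ev, ih]
  | query q k ih => simp only [Prog.bind, ev, ih]
  | loop body s k _ ih => simp only [Prog.bind, ev, ih]

theorem ev_mono (c : ℝ≥0∞) {α : Type} (P : Prog Q A α) {f g : α → ℝ≥0∞} (h : f ≤ g) :
    ev O c P f ≤ ev O c P g := by
  induction P with
  | ret a => simpa only [ev] using h a
  | rand μ k ih =>
    simp only [ev]
    exact ENNReal.tsum_le_tsum fun b => mul_le_mul_right (ih b h) _
  | query q k ih =>
    simp only [ev]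
    exact add_le_add_right (ENNReal.tsum_le_tsum fun b => mul_le_mul_right (ih b h) _) _
  | loop body s k ihb ih =>
    rw [ev_loop, ev_loop]
    refine iSup_mono fun N => ?_
    suffices H : ∀ s, (loopStep O c body fun b => ev O c (k b) f)^[N] (fun _ => 0) s ≤
        (loopStep O c body fun b => ev O c (k b) g)^[N] (fun _ => 0) s from H s
    induction N with
    | zero => intro s; exact le_rfl
    | succ N ihN =>
      intro s
      rw [Function.iterate_succ_apply', Function.iterate_succ_apply']
      refine ihb s fun x => ?_
      cases x with
      | inl x => exact ihN x
      | inr b => exact ih b h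

theorem loopStep_mono (c : ℝ≥0∞) {σ β : Type} (body : σ → Prog Q A (σ ⊕ β)) (h : β → ℝ≥0∞) :
    Monotone (loopStep O c body h) := by
  intro X Y hXY s
  refine ev_mono O c _ fun x => ?_
  cases x with
  | inl x => exact hXY x
  | inr b => exact le_rfl

theorem monotone_iterate_loopStep (c : ℝ≥0∞) {σ β : Type} (body : σ → Prog Q A (σ ⊕ β))
    (h : β → ℝ≥0∞) (s : σ) :
    Monotone fun N : ℕ => (loopStep O c body h)^[N] (fun _ => 0) s := by
  intro M N hMN
  exact (loopStep_mono O c body h).monotone_iterate_of_le_map (fun _ => zero_le) hMN s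

/-- The cost of the queries must be charged only once, hence the cost `0` in the second summand. For
loops, the suprema add up because truncated values increase with the number of rounds. -/
theorem ev_add (c : ℝ≥0∞) {α : Type} (P : Prog Q A α) (f g : α → ℝ≥0∞) :
    ev O c P (f + g) = ev O c P f + ev O 0 P g := by
  induction P with
  | ret a => simp only [ev, Pi.add_apply]
  | rand μ k ih => simp only [ev, ih, mul_add, ENNReal.tsum_add]
  | query q k ih => simp only [ev, ih, mul_add, ENNReal.tsum_add, zero_add, add_assoc]
  | loop body s k ihb ih =>
    rw [ev_loop, ev_loop, ev_loop, ENNReal.iSup_add_iSup_of_monotone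
      (monotone_iterate_loopStep O c body _ s) (monotone_iterate_loopStep O 0 body _ s)]
    refine iSup_congr fun N => ?_
    induction N generalizing s with
    | zero => simp
    | succ N ihN =>
      simp only [Function.iterate_succ_apply']
      rw [loopStep, loopStep, loopStep, ← ihb]
      congr 1
      funext x
      cases x with
      | inl x => exact ihN x
      | inr b => exact ih b f g

theorem ev_mul (a c : ℝ≥0∞) {α : Type} (P : Prog Q A α) (f : α → ℝ≥0∞) :
    ev O (a * c) P (fun x => a * f x) = a * ev O c P f := by
  induction P with
  | ret b => simp only [ev]
  | rand μ k ih => simp only [ev, ih, ← ENNReal.tsum_mul_left, mul_left_comm]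
  | query q k ih => simp only [ev, ih, mul_add, ← ENNReal.tsum_mul_left, mul_left_comm]
  | loop body s k ihb ih =>
    rw [ev_loop, ev_loop, ENNReal.mul_iSup]
    refine iSup_congr fun N => ?_
    induction N generalizing s with
    | zero => simp
    | succ N ihN =>
      simp only [Function.iterate_succ_apply']
      rw [loopStep, loopStep, ← ihb]
      congr 1
      funext x
      cases x with
      | inl x => exact ihN x
      | inr b => exact ih b f

theorem ev_zero_mul (a : ℝ≥0∞) {α : Type} (P : Prog Q A α) (f : α → ℝ≥0∞) :
    ev O 0 P (fun x => a * f x) = a * ev O 0 P f := by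
  simpa using ev_mul O a 0 P f

theorem ev_eq_add (c : ℝ≥0∞) {α : Type} (P : Prog Q A α) (f : α → ℝ≥0∞) :
    ev O c P f = ev O c P 0 + ev O 0 P f := by
  rw [← ev_add, zero_add]

/-- The hypothesis says that a run of `g q` at price `c'` per query has the same value as one query
`q` at price `c`, for every continuation; this requires the cost to be independent of the answer in
expectation. -/
theorem ev_substQuery {Q' : Type} {A' : Q' → Type} (O' : ∀ q, PMF (A' q)) {c c' : ℝ≥0∞}
    {g : ∀ q, Prog Q' A' (A q)}
    (hg : ∀ q f, ev O' c' (g q) f = c + ∑' r, O q r * f r)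
    {α : Type} (P : Prog Q A α) (f : α → ℝ≥0∞) :
    ev O' c' (P.substQuery g) f = ev O c P f := by
  induction P with
  | ret a => simp only [substQuery, ev]
  | rand μ k ih => simp only [substQuery, ev, ih]
  | query q k ih => simp only [substQuery, ev, ev_bind, hg, ih]
  | loop body s k ihb ih => simp only [substQuery, ev, ihb, ih]

/-- A supersolution of the equations for the values of a loop bounds them from above. -/
theorem ev_loop_le (c : ℝ≥0∞) {α σ β : Type} (body : σ → Prog Q A (σ ⊕ β)) (k : β → Prog Q A α)
    (f : α → ℝ≥0∞) (X : σ → ℝ≥0∞)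
    (hX : ∀ s, ev O c (body s) (Sum.elim X fun b => ev O c (k b) f) ≤ X s) (s : σ) :
    ev O c (loop body s k) f ≤ X s := by
  rw [ev_loop]
  refine iSup_le fun N => ?_
  suffices H : (loopStep O c body fun b => ev O c (k b) f)^[N] (fun _ => 0) ≤ X from H s
  induction N with
  | zero => exact fun _ => zero_le
  | succ N ihN =>
    rw [Function.iterate_succ_apply']
    exact (loopStep_mono O c body _ ihN).trans hX

theorem ev_zero_one_le {α : Type} (P : Prog Q A α) : ev O 0 P (fun _ => 1) ≤ 1 := by
  induction P with
  | ret a => simp only [ev, le_refl]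
  | rand μ k ih =>
    rw [ev_rand]
    calc _ ≤ ∑' b, μ b * 1 := ENNReal.tsum_le_tsum fun b => mul_le_mul_right (ih b) _
      _ = 1 := by simp
  | query q k ih =>
    rw [ev_query, zero_add]
    calc _ ≤ ∑' b, O q b * 1 := ENNReal.tsum_le_tsum fun b => mul_le_mul_right (ih b) _
      _ = 1 := by simp
  | loop body s k ihb ih =>
    refine ev_loop_le O 0 body k _ (fun _ => 1) (fun s => ?_) s
    refine (ev_mono O 0 _ fun x => ?_).trans (ihb s)
    cases x with
    | inl x => exact le_rfl
    | inr b => exact ih b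

theorem ev_zero_const_le {α : Type} (P : Prog Q A α) (b : ℝ≥0∞) :
    ev O 0 P (fun _ => b) ≤ b := by
  have h := ev_zero_mul O b P fun _ => 1
  simp only [mul_one] at h
  rw [h]
  exact mul_le_of_le_one_right zero_le (ev_zero_one_le O P)

theorem ev_const_le {α : Type} (c : ℝ≥0∞) (P : Prog Q A α) (b : ℝ≥0∞) :
    ev O c P (fun _ => b) ≤ ev O c P 0 + b := by
  rw [ev_eq_add]
  exact add_le_add_right (ev_zero_const_le O P b) _

/-- A loop halts almost surely if its body does and if some potential, finite everywhere, decreases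
by at least `1` in expectation in each round. -/
theorem ev_loop_one {σ β : Type} (body : σ → Prog Q A (σ ⊕ β))
    (hbody : ∀ s, ev O 0 (body s) (fun _ => 1) = 1) (T : σ → ℝ≥0∞) (hT : ∀ s, T s ≠ ∞)
    (hstep : ∀ s, 1 + ev O 0 (body s) (Sum.elim T fun _ => 0) ≤ T s) (s : σ) :
    ev O 0 (loop body s ret) (fun _ => 1) = 1 := by
  -- Markov's inequality: `N` times the probability of not halting within `N` rounds is at most the
  -- expected number of rounds, which `T s` bounds. It is stated without subtraction.
  have key : ∀ (N : ℕ) (s : σ),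
      (N : ℝ≥0∞) ≤ N * (loopStep O 0 body fun _ => 1)^[N] (fun _ => 0) s + T s := by
    intro N
    induction N with
    | zero => intro s; simp
    | succ N ih =>
      intro s
      rw [Function.iterate_succ_apply']
      set Y := (loopStep O 0 body fun _ => 1)^[N] (fun _ => 0) with hY
      have h1 : (N : ℝ≥0∞) ≤
          N * loopStep O 0 body (fun _ => 1) Y s + ev O 0 (body s) (Sum.elim T fun _ => 0) := by
        rw [loopStep, ← ev_zero_mul, ← ev_add]
        calc (N : ℝ≥0∞) = ev O 0 (body s) (fun _ => N * 1) := by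
              rw [ev_zero_mul O N, hbody, mul_one]
          _ ≤ _ := by
              refine ev_mono O 0 _ fun x => ?_
              cases x with
              | inl x => simpa using ih x
              | inr b => simp
      calc ((N + 1 : ℕ) : ℝ≥0∞) = N + 1 := by push_cast; rfl
        _ ≤ (N * loopStep O 0 body (fun _ => 1) Y s
              + ev O 0 (body s) (Sum.elim T fun _ => 0)) + 1 := add_le_add_left h1 1
        _ = N * loopStep O 0 body (fun _ => 1) Y s
              + (1 + ev O 0 (body s) (Sum.elim T fun _ => 0)) := by ring
        _ ≤ ((N + 1 : ℕ) : ℝ≥0∞) * loopStep O 0 body (fun _ => 1) Y s + T s := by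
            gcongr
            · exact Nat.le_succ N
            · exact hstep s
  refine le_antisymm (ev_zero_one_le O _) ?_
  obtain ⟨x, hx⟩ : ∃ x, x = ev O 0 (loop body s ret) (fun _ => 1) := ⟨_, rfl⟩
  rw [← hx]
  have hle : ∀ N : ℕ, (N : ℝ≥0∞) ≤ N * x + T s := fun N => by
    refine (key N s).trans ?_
    gcongr
    rw [hx, ev_loop]
    exact le_iSup (fun N : ℕ => (loopStep O 0 body fun b => ev O 0 (ret b) fun _ => 1)^[N]
      (fun _ => 0) s) N
  by_contra hlt
  rw [not_le] at hlt
  clear hx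
  have hx' : x ≠ ∞ := hlt.ne_top
  lift x to NNReal using hx'
  obtain ⟨t, ht⟩ := WithTop.ne_top_iff_exists.mp (hT s)
  change ((t : NNReal) : ℝ≥0∞) = T s at ht
  rw [← ht] at hle
  have hlt' : (x : ℝ) < 1 := by exact_mod_cast hlt
  -- If the halting probability were `x < 1`, then N(1 - x) ≤ t for all `N`, which fails for large
  -- `N`.
  obtain ⟨N, hN⟩ := exists_nat_gt ((t : ℝ) / (1 - x))
  have := hle N
  have h3 : (N : ℝ) ≤ N * x + t := by exact_mod_cast this
  rw [div_lt_iff₀ (by linarith)] at hN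
  nlinarith

/-- If a loop with output a bit halts almost surely, then supersolutions `V` and `W = 1 - V` of the
equations for the probabilities of `true` and `false` give these probabilities exactly. -/
theorem ev_loop_eq {σ : Type} (body : σ → Prog Q A (σ ⊕ Bool)) (V W : σ → ℝ≥0∞)
    (hVW : ∀ s, V s + W s = 1)
    (hV : ∀ s, ev O 0 (body s) (Sum.elim V (({true} : Set Bool).indicator 1)) ≤ V s)
    (hW : ∀ s, ev O 0 (body s) (Sum.elim W (({false} : Set Bool).indicator 1)) ≤ W s)
    (s : σ) (h1 : ev O 0 (loop body s ret) (fun _ => 1) = 1) :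
    ev O 0 (loop body s ret) (({true} : Set Bool).indicator 1) = V s := by
  have hv := ev_loop_le O 0 body ret (({true} : Set Bool).indicator 1) V
    (by simpa only [ev_ret] using hV) s
  have hw := ev_loop_le O 0 body ret (({false} : Set Bool).indicator 1) W
    (by simpa only [ev_ret] using hW) s
  have hsum : ev O 0 (loop body s ret) (({true} : Set Bool).indicator 1) +
      ev O 0 (loop body s ret) (({false} : Set Bool).indicator 1) = 1 := by
    rw [← ev_add, ← h1]
    congr 1
    funext b
    cases b <;> simp
  refine le_antisymm hv ?_
  have hWtop : W s ≠ ∞ := fun h => by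
    have := hVW s
    rw [h, add_top] at this
    exact ENNReal.top_ne_one this
  -- Both pairs sum to `1`, so the upper bound for `false` is a lower bound for `true`.
  refine (ENNReal.add_le_add_iff_right hWtop).mp ?_
  rw [hVW, ← hsum]
  exact add_le_add_right hw _

end Prog

/-! ### Coin flips and the geometric distribution -/

/-- A coin of bias `x`, if `0 ≤ x ≤ 1`. -/
noncomputable def flip01 (x : ℝ) : PMF Bool := bern (min x.toNNReal 1) (min_le_right _ _)

theorem tsum_bern (p : NNReal) (hp : p ≤ 1) (f : Bool → ℝ≥0∞) :
    ∑' b, bern p hp b * f b = p * f true + (1 - p) * f false := by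
  rw [tsum_bool, add_comm]
  simp [bern]

/-- Transfers estimates of one step of the walk to real arithmetic, where 1 - x is a true
subtraction. -/
theorem tsum_flip01_le {x : ℝ} (h0 : 0 ≤ x) (h1 : x ≤ 1) {f : Bool → ℝ≥0∞} {a b r : ℝ}
    (ha : 0 ≤ a) (hb : 0 ≤ b) (hfa : f true ≤ ENNReal.ofReal a) (hfb : f false ≤ ENNReal.ofReal b)
    (hr : x * a + (1 - x) * b ≤ r) : ∑' c, flip01 x c * f c ≤ ENNReal.ofReal r := by
  have hx : ((min x.toNNReal 1 : NNReal) : ℝ≥0∞) = ENNReal.ofReal x := by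
    rw [min_eq_left (by simpa using h1)]; rfl
  have hx' : 1 - ENNReal.ofReal x = ENNReal.ofReal (1 - x) := by
    rw [ENNReal.ofReal_sub _ h0, ENNReal.ofReal_one]
  rw [flip01, tsum_bern, hx, hx']
  calc _ ≤ ENNReal.ofReal x * ENNReal.ofReal a + ENNReal.ofReal (1 - x) * ENNReal.ofReal b := by
        gcongr
    _ = ENNReal.ofReal (x * a + (1 - x) * b) := by
        rw [← ENNReal.ofReal_mul h0, ← ENNReal.ofReal_mul (by linarith),
          ← ENNReal.ofReal_add (by positivity) (mul_nonneg (by linarith) hb)]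
    _ ≤ _ := ENNReal.ofReal_le_ofReal hr

theorem tsum_coin_le {p : NNReal} (hp : p ≤ 1) {f : Bool → ℝ≥0∞} {a b r : ℝ}
    (ha : 0 ≤ a) (hb : 0 ≤ b) (hfa : f true ≤ ENNReal.ofReal a) (hfb : f false ≤ ENNReal.ofReal b)
    (hr : p * a + (1 - p) * b ≤ r) : ∑' c, coin p hp () c * f c ≤ ENNReal.ofReal r := by
  have : coin p hp () = flip01 p := by
    simp [coin, flip01, hp]
  rw [this]
  exact tsum_flip01_le p.2 (by exact_mod_cast hp) ha hb hfa hfb hr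

/-- The geometric distribution on `ℕ` with parameter `1 / 2`. -/
noncomputable def geomHalf : PMF ℕ :=
  ⟨fun n => 2⁻¹ ^ (n + 1), by
    have h := ENNReal.summable (f := fun n : ℕ => (2⁻¹ : ℝ≥0∞) ^ (n + 1)) |>.hasSum
    rwa [ENNReal.tsum_geometric_add_one, ENNReal.one_sub_inv_two, inv_inv,
      ENNReal.inv_mul_cancel (by simp) (by simp)] at h⟩

/-! ### A Bernoulli factory for 1/(2p) -/

namespace InvTwoFactory

/-- The multiplier of the failure probability in phase `j`. -/
noncomputable def rate (j : ℕ) : ℝ := 5 / 2 - (1 / 2) ^ (j + 1)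

/-- In phase `j` and at height `i`, the loop samples a bit that is `true` with probability
`(rate j * q) ^ i`, where `q` is the probability that the coin shows `false`. -/
noncomputable def round (s : ℕ × ℕ) : Prog Unit (fun _ => Bool) ((ℕ × ℕ) ⊕ Bool) :=
  if s.2 = 0 then Prog.ret (Sum.inr true)
  -- At the barrier the walk either ends with `false` or enters the next phase at the same height.
  -- The barrier doubles because the increments of the rate halve.
  else if 30 * 2 ^ s.1 ≤ s.2 then
    Prog.rand (flip01 ((rate s.1 / rate (s.1 + 1)) ^ s.2)) fun b =>
      Prog.ret (if b then Sum.inl (s.1 + 1, s.2) else Sum.inr false)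
  else
    Prog.rand (flip01 (1 / (rate s.1 + 1))) fun b =>
      if b then Prog.ret (Sum.inl (s.1, s.2 + 1))
      else Prog.query () fun r => Prog.ret (Sum.inl (if r then s else (s.1, s.2 - 1)))

noncomputable def factory : CoinProg :=
  Prog.rand geomHalf fun i => Prog.loop round (0, i) Prog.ret

theorem two_le_rate (j : ℕ) : 2 ≤ rate j := by
  have : ((1 : ℝ) / 2) ^ j ≤ 1 := pow_le_one₀ (by norm_num) (by norm_num)
  rw [rate, pow_succ]; linarith

theorem rate_le (j : ℕ) : rate j ≤ 5 / 2 := by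
  have : (0 : ℝ) < (1 / 2) ^ (j + 1) := by positivity
  rw [rate]; linarith

theorem rate_succ (j : ℕ) : rate (j + 1) = rate j + (1 / 2) ^ (j + 2) := by
  rw [rate, rate]; ring

theorem rate_ratio_nonneg (j : ℕ) : 0 ≤ rate j / rate (j + 1) :=
  div_nonneg (by linarith [two_le_rate j]) (by linarith [two_le_rate (j + 1)])

theorem rate_ratio_le_one (j : ℕ) : rate j / rate (j + 1) ≤ 1 := by
  have : (0 : ℝ) < (1 / 2) ^ (j + 2) := by positivity
  rw [div_le_one (by linarith [two_le_rate (j + 1)]), rate_succ]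
  linarith

/-- Bernoulli's inequality: the relative increment of the rate is at least 2^{-j}/10, and 30 · 2^j
such increments add up to 3. -/
theorem rate_ratio_pow_le {j i : ℕ} (h : 30 * 2 ^ j ≤ i) :
    (rate j / rate (j + 1)) ^ i ≤ 1 / 4 := by
  have h2 := two_le_rate j
  have h3 := rate_le j
  have hpow : (0 : ℝ) < (1 / 2) ^ j := by positivity
  have hd : (1 / 2) ^ j / 10 ≤ rate (j + 1) / rate j - 1 := by
    rw [rate_succ, add_div, div_self (by linarith), add_sub_cancel_left, pow_add,
      div_le_div_iff₀ (by norm_num) (by linarith)]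
    nlinarith
  have hb := one_add_mul_le_pow (a := rate (j + 1) / rate j - 1)
    (by linarith) i
  rw [add_sub_cancel] at hb
  have hi : (30 : ℝ) * 2 ^ j ≤ i := by exact_mod_cast h
  have h4 : (4 : ℝ) ≤ (rate (j + 1) / rate j) ^ i := by
    refine le_trans ?_ hb
    have : (30 : ℝ) * 2 ^ j * ((1 / 2) ^ j / 10) ≤ i * (rate (j + 1) / rate j - 1) :=
      mul_le_mul hi hd (by positivity) (by positivity)
    have h5 : (2 : ℝ) ^ j * (1 / 2) ^ j = 1 := by rw [← mul_pow]; norm_num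
    nlinarith
  rw [← inv_div, inv_pow, one_div]
  exact inv_anti₀ (by norm_num) h4

theorem rate_zero : rate 0 = 2 := by norm_num [rate]

/-- The probability of the output `true` from a state of the loop. -/
noncomputable def value (p : NNReal) (s : ℕ × ℕ) : ℝ := (rate s.1 * (1 - p)) ^ s.2

theorem bias_bounds {p : NNReal} (hp : p ≤ 1) (hp' : 2 / 3 ≤ p) :
    (2 / 3 : ℝ) ≤ p ∧ (p : ℝ) ≤ 1 :=
  ⟨by exact_mod_cast hp', by exact_mod_cast hp⟩

/-- The rates stay below 5/2 and 1 - p ≤ 1/3, so the base stays away from 1 in all phases; this gap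
is the source of the upward drift. -/
theorem base_bounds {p : NNReal} (hp : p ≤ 1) (hp' : 2 / 3 ≤ p) (j : ℕ) :
    0 ≤ rate j * (1 - p) ∧ rate j * (1 - p) ≤ 5 / 6 := by
  obtain ⟨h1, h2⟩ := bias_bounds hp hp'
  have h3 := two_le_rate j
  have h4 := rate_le j
  constructor
  · exact mul_nonneg (by linarith) (by linarith)
  · nlinarith

theorem value_nonneg {p : NNReal} (hp : p ≤ 1) (hp' : 2 / 3 ≤ p) (s : ℕ × ℕ) : 0 ≤ value p s :=
  pow_nonneg (base_bounds hp hp' s.1).1 _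

theorem value_le_one {p : NNReal} (hp : p ≤ 1) (hp' : 2 / 3 ≤ p) (s : ℕ × ℕ) : value p s ≤ 1 :=
  pow_le_one₀ (base_bounds hp hp' s.1).1 (by linarith [(base_bounds hp hp' s.1).2])

/-- A bound for the expected value of one round. -/
theorem ev_round_le {p : NNReal} (hp : p ≤ 1) (X : ℕ × ℕ → ℝ) (hX : ∀ s, 0 ≤ X s)
    (h : Bool → ℝ≥0∞) (y : Bool → ℝ) (hy : ∀ b, 0 ≤ y b) (hh : ∀ b, h b = ENNReal.ofReal (y b))
    (Y : ℕ × ℕ → ℝ)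
    (hzero : ∀ j, y true ≤ Y (j, 0))
    (hhigh : ∀ j i, i ≠ 0 → 30 * 2 ^ j ≤ i →
      (rate j / rate (j + 1)) ^ i * X (j + 1, i) +
        (1 - (rate j / rate (j + 1)) ^ i) * y false ≤ Y (j, i))
    (hlow : ∀ j i, i + 1 < 30 * 2 ^ j →
      1 / (rate j + 1) * X (j, i + 2) + (1 - 1 / (rate j + 1)) *
        (p * X (j, i + 1) + (1 - p) * X (j, i)) ≤ Y (j, i + 1)) (s : ℕ × ℕ) :
    Prog.ev (coin p hp) 0 (round s) (Sum.elim (fun t => ENNReal.ofReal (X t)) h) ≤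
      ENNReal.ofReal (Y s) := by
  obtain ⟨j, i⟩ := s
  rw [round]
  split_ifs with h0 h1
  · simp only at h0
    subst h0
    rw [Prog.ev_ret, Sum.elim_inr, hh]
    exact ENNReal.ofReal_le_ofReal (hzero j)
  · rw [Prog.ev_rand]
    refine tsum_flip01_le (pow_nonneg (rate_ratio_nonneg j) _)
      (pow_le_one₀ (rate_ratio_nonneg j) (rate_ratio_le_one j)) (hX (j + 1, i)) (hy false)
      ?_ ?_ (hhigh j i h0 h1)
    · simp [Prog.ev_ret]
    · simp [Prog.ev_ret, hh]
  · obtain ⟨i, rfl⟩ := Nat.exists_eq_succ_of_ne_zero h0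
    have h2 := two_le_rate j
    have h3 : (0 : ℝ) ≤ 1 - p := by
      have : (p : ℝ) ≤ 1 := by exact_mod_cast hp
      linarith
    rw [Prog.ev_rand]
    refine tsum_flip01_le (by positivity) (by rw [div_le_one (by linarith)]; linarith)
      (hX (j, i + 2)) (b := p * X (j, i + 1) + (1 - p) * X (j, i)) ?_ ?_ ?_
      (hlow j i (not_le.mp h1))
    · exact add_nonneg (mul_nonneg p.2 (hX _)) (mul_nonneg h3 (hX _))
    · simp [Prog.ev_ret]
    · simp only [Bool.false_eq_true, if_false]
      rw [Prog.ev_query, zero_add]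
      refine tsum_coin_le hp (hX (j, i + 1)) (hX (j, i)) ?_ ?_ le_rfl
      · simp [Prog.ev_ret]
      · simp [Prog.ev_ret]

theorem value_high (p : NNReal) (j i : ℕ) :
    (rate j / rate (j + 1)) ^ i * value p (j + 1, i) = value p (j, i) := by
  have h2 := two_le_rate (j + 1)
  rw [value, value, ← mul_pow, ← mul_assoc, div_mul_cancel₀ _ (by linarith)]

/-- Harmonicity: with c the rate and x = c(1 - p), the left side is x^i (x² + cpx + x)/(c + 1), and
cpx = cx - x². -/
theorem value_low (p : NNReal) (j i : ℕ) :
    1 / (rate j + 1) * value p (j, i + 2) + (1 - 1 / (rate j + 1)) *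
      (p * value p (j, i + 1) + (1 - p) * value p (j, i)) = value p (j, i + 1) := by
  have h2 := two_le_rate j
  simp only [value, pow_add]
  field_simp
  ring

/-- A bound for the expected number of rounds from a state of the loop. -/
noncomputable def potential (s : ℕ × ℕ) : ℝ :=
  -- Below the barrier the upward drift is at least (1 - 5/6)/(5/2 + 1) = 1/21, so the slope 21
  -- gains 1 per round. At the barrier the potential is at least (1262 - 21 · 30) 2^j = 632 · 2^j,
  -- while survival with probability at most 1/4 leaves at most 1262 · 2^{j+1}/4 = 631 · 2^j.
  1262 * 2 ^ s.1 - 21 * min (s.2 : ℝ) (30 * 2 ^ s.1)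

theorem one_le_potential (s : ℕ × ℕ) : 1 ≤ potential s := by
  have h1 : (1 : ℝ) ≤ 2 ^ s.1 := one_le_pow₀ (by norm_num)
  have h2 := min_le_right (s.2 : ℝ) (30 * 2 ^ s.1)
  rw [potential]
  linarith

theorem ev_round_potential_le {p : NNReal} (hp : p ≤ 1) (hp' : 2 / 3 ≤ p) (s : ℕ × ℕ) :
    1 + Prog.ev (coin p hp) 0 (round s)
      (Sum.elim (fun t => ENNReal.ofReal (potential t)) fun _ => 0) ≤
      ENNReal.ofReal (potential s) := by
  have hnn : ∀ s, 0 ≤ potential s := fun s => zero_le_one.trans (one_le_potential s)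
  have h := ev_round_le hp potential hnn (fun _ => 0) (fun _ => 0) (fun _ => le_rfl) (by simp)
    (fun s => potential s - 1) (fun j => by linarith [one_le_potential (j, 0)]) ?_ ?_ s
  · calc _ ≤ 1 + ENNReal.ofReal (potential s - 1) := add_le_add_right h 1
      _ = _ := by
        rw [← ENNReal.ofReal_one, ← ENNReal.ofReal_add zero_le_one
          (by linarith [one_le_potential s])]
        congr 1
        ring
  · intro j i _ hi
    have h1 := rate_ratio_pow_le hi
    have h2 : potential (j + 1, i) ≤ 1262 * 2 ^ (j + 1) := by
      have : (0 : ℝ) ≤ min (i : ℝ) (30 * 2 ^ (j + 1)) := by positivity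
      rw [potential]
      linarith
    have h3 : (1 : ℝ) ≤ 2 ^ j := one_le_pow₀ (by norm_num)
    have h4 : (rate j / rate (j + 1)) ^ i * potential (j + 1, i) ≤
        1 / 4 * (1262 * 2 ^ (j + 1)) :=
      mul_le_mul h1 h2 (hnn _) (by norm_num)
    have h5 := min_le_right (i : ℝ) (30 * 2 ^ j)
    rw [pow_succ] at h4
    simp only [potential] at h4 ⊢
    linarith
  · intro j i hi
    -- An upward step reaches at most the barrier itself, so the minimum is the height in all three
    -- states.
    have hi' : ((i : ℝ) + 1) + 1 ≤ 30 * 2 ^ j := by exact_mod_cast hi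
    have h1 := base_bounds hp hp' j
    have h2 := two_le_rate j
    have h3 := rate_le j
    have e1 : potential (j, i + 2) = 1262 * 2 ^ j - 21 * (i + 2) := by
      rw [potential]; push_cast; rw [min_eq_left (by linarith)]
    have e2 : potential (j, i + 1) = 1262 * 2 ^ j - 21 * (i + 1) := by
      rw [potential]; push_cast; rw [min_eq_left (by linarith)]
    have e3 : potential (j, i) = 1262 * 2 ^ j - 21 * i := by
      rw [potential, min_eq_left (by simp only; linarith)]
    rw [e1, e2, e3]
    have h4 : 1 / (rate j + 1) * (1262 * 2 ^ j - 21 * (i + 2)) + (1 - 1 / (rate j + 1)) *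
        (p * (1262 * 2 ^ j - 21 * (i + 1)) + (1 - p) * (1262 * 2 ^ j - 21 * i)) =
        1262 * 2 ^ j - 21 * (i + 1) - 21 * ((1 - rate j * (1 - p)) / (rate j + 1)) := by
      field_simp
      ring
    rw [h4]
    have h5 : 1 / 21 ≤ (1 - rate j * (1 - p)) / (rate j + 1) := by
      rw [div_le_div_iff₀ (by norm_num) (by linarith)]
      linarith
    linarith

theorem ev_round_one {p : NNReal} (hp : p ≤ 1) (s : ℕ × ℕ) :
    Prog.ev (coin p hp) 0 (round s) (fun _ => 1) = 1 := by
  rw [round]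
  split_ifs
  · simp only [Prog.ev_ret]
  · simp only [Prog.ev_rand, Prog.ev_ret, mul_one, PMF.tsum_coe]
  · have : ∀ b : Bool, Prog.ev (coin p hp) 0
        (if b = true then Prog.ret (Sum.inl (s.1, s.2 + 1))
          else Prog.query () fun r : Bool => Prog.ret (Sum.inl (if r then s else (s.1, s.2 - 1))) :
          Prog Unit (fun _ => Bool) ((ℕ × ℕ) ⊕ Bool)) (fun _ => 1) = 1 := by
      intro b
      split_ifs <;>
        simp only [Prog.ev_ret, Prog.ev_query, mul_one, zero_add, PMF.tsum_coe]
    rw [Prog.ev_rand]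
    simp only [this, mul_one, PMF.tsum_coe]

theorem expected_round_le {p : NNReal} (hp : p ≤ 1) (s : ℕ × ℕ) :
    Prog.ev (coin p hp) 1 (round s) 0 ≤ 1 := by
  rw [round]
  split_ifs
  · simp [Prog.ev_ret]
  · simp [Prog.ev_rand, Prog.ev_ret]
  · rw [Prog.ev_rand]
    calc _ ≤ ∑' b, flip01 (1 / (rate s.1 + 1)) b * 1 := by
          refine ENNReal.tsum_le_tsum fun b => mul_le_mul_right ?_ _
          split_ifs <;> simp [Prog.ev_ret, Prog.ev_query]
      _ = 1 := by simp only [mul_one, PMF.tsum_coe]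

theorem ev_loop_one {p : NNReal} (hp : p ≤ 1) (hp' : 2 / 3 ≤ p) (s : ℕ × ℕ) :
    Prog.ev (coin p hp) 0 (Prog.loop round s Prog.ret) (fun _ => 1) = 1 :=
  Prog.ev_loop_one _ round (ev_round_one hp) _ (fun _ => ENNReal.ofReal_ne_top)
    (ev_round_potential_le hp hp') s

/-- `value` and its complement satisfy the equations of the loop for the outputs `true` and `false`,
and the loop halts almost surely. -/
theorem ev_loop_true {p : NNReal} (hp : p ≤ 1) (hp' : 2 / 3 ≤ p) (s : ℕ × ℕ) :
    Prog.ev (coin p hp) 0 (Prog.loop round s Prog.ret) (({true} : Set Bool).indicator 1) =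
      ENNReal.ofReal (value p s) := by
  have h0 := value_nonneg hp hp'
  have h1 := value_le_one hp hp'
  refine Prog.ev_loop_eq _ round (fun s => ENNReal.ofReal (value p s))
    (fun s => ENNReal.ofReal (1 - value p s)) (fun s => ?_) (fun s => ?_) (fun s => ?_) s
    (ev_loop_one hp hp' s)
  · rw [← ENNReal.ofReal_add (h0 s) (by linarith [h1 s]), add_sub_cancel, ENNReal.ofReal_one]
  · refine ev_round_le hp (value p) h0 _ (fun b => if b then 1 else 0)
      (fun b => by cases b <;> simp) (fun b => by cases b <;> simp) (value p) ?_ ?_ ?_ s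
    · simp [value]
    · intro j i _ _
      simp [value_high]
    · intro j i _
      rw [value_low]
  · refine ev_round_le hp (fun s => 1 - value p s) (fun s => by linarith [h1 s]) _
      (fun b => if b then 0 else 1) (fun b => by cases b <;> simp) (fun b => by cases b <;> simp)
      (fun s => 1 - value p s) ?_ ?_ ?_ s
    · simp [value]
    · intro j i _ _
      have := value_high p j i
      simp only [Bool.false_eq_true, if_false]
      linarith
    · intro j i _
      have := value_low p j i
      linarith

theorem ev_one {p : NNReal} (hp : p ≤ 1) (hp' : 2 / 3 ≤ p) :
    Prog.ev (coin p hp) 0 factory (fun _ => 1) = 1 := by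
  rw [factory, Prog.ev_rand]
  simp [ev_loop_one hp hp']

theorem prob_true {p : NNReal} (hp : p ≤ 1) (hp' : 2 / 3 ≤ p) :
    factory.prob (coin p hp) {true} = ENNReal.ofReal (1 / (2 * (p : ℝ))) := by
  obtain ⟨h1, h2⟩ := bias_bounds hp hp'
  have hs := (hasSum_geometric_of_lt_one (r := 1 - (p : ℝ)) (by linarith)
    (by linarith)).mul_left (1 / 2)
  rw [Prog.prob, factory, Prog.ev_rand]
  simp only [ev_loop_true hp hp']
  have e : ∀ i : ℕ, geomHalf i * ENNReal.ofReal (value p (0, i)) =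
      ENNReal.ofReal (1 / 2 * (1 - (p : ℝ)) ^ i) := by
    intro i
    have : geomHalf i = ENNReal.ofReal ((1 / 2) ^ (i + 1)) := by
      rw [ENNReal.ofReal_pow (by norm_num), one_div, ENNReal.ofReal_inv_of_pos (by norm_num)]
      simp only [ENNReal.ofReal_ofNat]
      rfl
    rw [this, ← ENNReal.ofReal_mul (by positivity), value, rate_zero, mul_pow, pow_succ,
      ← mul_assoc, mul_right_comm _ (1 / 2 : ℝ), ← mul_pow]
    norm_num
  simp only [e]
  rw [← ENNReal.ofReal_tsum_of_nonneg (fun i => mul_nonneg (by norm_num)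
    (pow_nonneg (by linarith) _)) hs.summable, hs.tsum_eq, sub_sub_cancel]
  congr 1
  field_simp

/-- A round flips the coin at most once, and the potential in phase 0 is at most 1262 whatever the
initial height. -/
theorem expectedQueries_le {p : NNReal} (hp : p ≤ 1) (hp' : 2 / 3 ≤ p) :
    factory.expectedQueries (coin p hp) ≤ ((1262 : NNReal) : ℝ≥0∞) := by
  rw [Prog.expectedQueries, factory, Prog.ev_rand]
  have h : ∀ i : ℕ, Prog.ev (coin p hp) 1 (Prog.loop round (0, i) Prog.ret) 0 ≤ 1262 := by
    intro i
    refine (Prog.ev_loop_le _ 1 round Prog.ret 0 (fun s => ENNReal.ofReal (potential s))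
      (fun s => ?_) (0, i)).trans ?_
    · rw [Prog.ev_eq_add]
      simp only [Prog.ev_ret, Pi.zero_apply]
      exact (add_le_add_left (expected_round_le hp s) _).trans (ev_round_potential_le hp hp' s)
    · refine ENNReal.ofReal_le_of_le_toReal ?_
      have : (0 : ℝ) ≤ min (i : ℝ) (30 * 2 ^ 0) := by positivity
      simp only [potential, pow_zero] at this ⊢
      simp
  calc _ ≤ ∑' i, geomHalf i * 1262 := ENNReal.tsum_le_tsum fun i => mul_le_mul_right (h i) _
    _ = _ := by rw [ENNReal.tsum_mul_right, PMF.tsum_coe, one_mul]; rfl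

theorem isInvTwoFactory : IsInvTwoFactory factory := by
  refine ⟨fun p hp hp' => ⟨prob_true hp hp', ?_⟩, 1262, fun p hp hp' => expectedQueries_le hp hp'⟩
  obtain ⟨h1, h2⟩ := bias_bounds hp hp'
  have hsum : factory.prob (coin p hp) {true} + factory.prob (coin p hp) {false} = 1 := by
    rw [Prog.prob, Prog.prob, ← Prog.ev_add, ← ev_one hp hp']
    congr 1
    funext b
    cases b <;> simp
  rw [prob_true hp hp'] at hsum
  rw [ENNReal.ofReal_sub _ (by positivity), ENNReal.ofReal_one, ← hsum,
    ENNReal.add_sub_cancel_left ENNReal.ofReal_ne_top]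

end InvTwoFactory

/-! ### Uniform draws, halting and repetition -/

theorem tsum_uniformBelow {k : ℕ} (hk : 0 < k) (f : ℕ → ℝ≥0∞) :
    ∑' i, uniformBelow k i * f i = (k : ℝ≥0∞)⁻¹ * ∑ i ∈ Finset.range k, f i := by
  have hne : (Finset.range k).Nonempty := ⟨0, Finset.mem_range.mpr hk⟩
  have e : uniformBelow k = PMF.uniformOfFinset (Finset.range k) hne := dif_pos hk
  rw [e, Finset.mul_sum]
  rw [tsum_eq_sum (s := Finset.range k)]
  · refine Finset.sum_congr rfl fun i hi => ?_
    rw [PMF.uniformOfFinset_apply_of_mem _ hi, Finset.card_range]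
  · intro i hi
    rw [PMF.uniformOfFinset_apply_of_notMem _ hi, zero_mul]

namespace Prog

variable {Q : Type} {A : Q → Type} (O : ∀ q, PMF (A q))

theorem expectedQueries_bind_le {α β : Type} (P : Prog Q A α) (g : α → Prog Q A β) {a b : ℝ≥0∞}
    (hP : expectedQueries O P ≤ a) (hg : ∀ x, expectedQueries O (g x) ≤ b) :
    expectedQueries O (P.bind g) ≤ a + b := by
  rw [expectedQueries, ev_bind]
  exact (ev_mono O 1 P hg).trans ((ev_const_le O 1 P b).trans (add_le_add_left hP b))

theorem expectedQueries_ret {α : Type} (a : α) : expectedQueries O (ret a) = 0 := by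
  rw [expectedQueries, ev_ret, Pi.zero_apply]

theorem expectedQueries_ask (q : Q) : expectedQueries O (ask q) = 1 := by
  simp [expectedQueries, ev_ask]

theorem expectedQueries_sample {β : Type} (μ : PMF β) : expectedQueries O (sample μ) = 0 := by
  simp [expectedQueries, ev_sample]

theorem ev_bool (P : Prog Q A Bool) (f : Bool → ℝ≥0∞) :
    ev O 0 P f = P.prob O {true} * f true + P.prob O {false} * f false := by
  rw [prob, prob, mul_comm, mul_comm _ (f false), ← ev_zero_mul, ← ev_zero_mul, ← ev_add]
  congr 1
  funext b
  cases b <;> simp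

/-- The program `P` halts almost surely. -/
def Halts {α : Type} (P : Prog Q A α) : Prop := ev O 0 P (fun _ => 1) = 1

variable {O}

theorem Halts.ret {α : Type} (a : α) : Halts O (ret a : Prog Q A α) := ev_ret _ _ _ _

theorem Halts.bind {α β : Type} {P : Prog Q A α} {g : α → Prog Q A β} (hP : Halts O P)
    (hg : ∀ x, Halts O (g x)) : Halts O (P.bind g) := by
  unfold Halts at *
  rw [ev_bind]
  simp only [hg, hP]

theorem Halts.ask (q : Q) : Halts O (ask q) := by simp [Halts, ev_ask]

theorem Halts.sample {β : Type} (μ : PMF β) : Halts O (sample μ : Prog Q A β) := by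
  simp [Halts, ev_sample]

variable (O)

theorem repeatUntil_eq {α : Type} (P : Prog Q A (Option α)) :
    repeatUntil P = loop (fun _ : Unit => P.bind fun r =>
      r.elim (Prog.ret (Sum.inl ())) fun a => Prog.ret (Sum.inr a)) () Prog.ret := by
  unfold repeatUntil
  congr
  funext _
  congr
  funext r
  cases r <;> rfl

theorem ev_elim (c : ℝ≥0∞) {α : Type} (P : Prog Q A (Option α)) (x : ℝ≥0∞) (f : α → ℝ≥0∞) :
    ev O c P (fun r => r.elim x f) =
      ev O c P (fun r => r.elim 0 f) + ev O 0 P (fun r => r.elim 1 fun _ => 0) * x := by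
  rw [mul_comm, ← ev_zero_mul, ← ev_add]
  congr 1
  funext r
  cases r <;> simp

/-- The value of a repetition in terms of the value of one round. -/
theorem ev_repeatUntil_fixed (c : ℝ≥0∞) {α : Type} (P : Prog Q A (Option α)) (f : α → ℝ≥0∞) :
    ev O c (repeatUntil P) f =
      ev O c P (fun r => r.elim 0 f) +
        ev O 0 P (fun r => r.elim 1 fun _ => 0) * ev O c (repeatUntil P) f := by
  set body : Unit → Prog Q A (Unit ⊕ α) := fun _ : Unit => P.bind fun r =>
      r.elim (Prog.ret (Sum.inl ())) fun a => Prog.ret (Sum.inr a) with hbody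
  have hstep : ∀ X : Unit → ℝ≥0∞, ∀ s, loopStep O c body (fun b => ev O c (Prog.ret b) f) X s =
      ev O c P (fun r => r.elim 0 f) + ev O 0 P (fun r => r.elim 1 fun _ => 0) * X () := by
    intro X s
    rw [← ev_elim, loopStep, hbody, ev_bind]
    congr 1
    funext r
    cases r <;> simp [ev_ret]
  have hmono := monotone_iterate_loopStep O c body (fun b => ev O c (Prog.ret b) f) ()
  have e : ev O c (repeatUntil P) f = ⨆ N : ℕ,
      (loopStep O c body fun b => ev O c (Prog.ret b) f)^[N] (fun _ => 0) () := by
    rw [repeatUntil_eq, ev_loop]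
  conv_rhs => rw [e, ENNReal.mul_iSup, ENNReal.add_iSup]
  rw [e, ← hmono.iSup_nat_add 1]
  refine iSup_congr fun N => ?_
  rw [Function.iterate_succ_apply', hstep]

/-- With T the value of a round in which failure counts as 0, and with failure probability 1 - S,
the number T/S solves X = T + (1 - S)X, so it is a supersolution. -/
theorem ev_repeatUntil_le (c : ℝ≥0∞) {α : Type} (P : Prog Q A (Option α)) (f : α → ℝ≥0∞)
    {S : ℝ≥0∞} (hS : ev O 0 P (fun r => r.elim 1 fun _ => 0) + S = 1) (hS0 : S ≠ 0) :
    ev O c (repeatUntil P) f ≤ ev O c P (fun r => r.elim 0 f) / S := by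
  have hS1 : S ≠ ∞ := fun h => by rw [h, add_top] at hS; exact ENNReal.top_ne_one hS
  rw [repeatUntil_eq]
  refine ev_loop_le O c _ _ f (fun _ => ev O c P (fun r => r.elim 0 f) / S) (fun s => ?_) ()
  rw [ev_bind]
  set T := ev O c P (fun r => r.elim 0 f) with hT
  calc _ = ev O c P (fun r => r.elim (T / S) f) := by
        congr 1
        funext r
        cases r <;> simp [ev_ret]
    _ = T / S * S + ev O 0 P (fun r => r.elim 1 fun _ => 0) * (T / S) := by
        rw [ev_elim, ENNReal.div_mul_cancel hS0 hS1]
    _ = (ev O 0 P (fun r => r.elim 1 fun _ => 0) + S) * (T / S) := by ring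
    _ ≤ T / S := by rw [hS, one_mul]

/-- The fixed point equation determines the value only once it is known to be finite, since infinity
may solve it too; the upper bound supplies finiteness. -/
theorem ev_repeatUntil (c : ℝ≥0∞) {α : Type} (P : Prog Q A (Option α)) (f : α → ℝ≥0∞)
    {S : ℝ≥0∞} (hS : ev O 0 P (fun r => r.elim 1 fun _ => 0) + S = 1) (hS0 : S ≠ 0)
    (hT : ev O c P (fun r => r.elim 0 f) ≠ ∞) :
    ev O c (repeatUntil P) f = ev O c P (fun r => r.elim 0 f) / S := by
  have hS1 : S ≠ ∞ := fun h => by rw [h, add_top] at hS; exact ENNReal.top_ne_one hS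
  have hfin : ev O c (repeatUntil P) f ≠ ∞ :=
    ne_top_of_le_ne_top (ENNReal.div_ne_top hT hS0) (ev_repeatUntil_le O c P f hS hS0)
  have hfix := ev_repeatUntil_fixed O c P f
  set X := ev O c (repeatUntil P) f
  set r := ev O 0 P (fun r => r.elim 1 fun _ => 0)
  have hr : r ≠ ∞ := fun h => by rw [h, top_add] at hS; exact ENNReal.top_ne_one hS
  rw [ENNReal.eq_div_iff hS0 hS1]
  refine (ENNReal.add_left_inj (ENNReal.mul_ne_top hr hfin)).mp ?_
  rw [← hfix, ← add_mul, add_comm, hS, one_mul]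

end Prog

/-! ### Light neighbors and one attempt -/

section Graph

variable {V : Type}

theorem randomNeighbor_eq (v : V) : randomNeighbor v = (askDegree v).bind fun d =>
    (Prog.sample (uniformBelow d)).bind fun j => askNeighbor v j := rfl

/-- The part of an attempt after the draw of a light vertex `u` and its neighbor `v`. -/
noncomputable def extendEdge (θ : ℕ) (u v : V) : GraphProg V (Option (V × V)) :=
  (Prog.sample (bern (1 / 3) one_third_le_one)).bind fun B =>
    if B = true then Prog.ret (some (u, v))
    else (askDegree v).bind fun d =>
      if d > θ then
        (randomNeighbor v).bind fun o => o.elim (Prog.ret none) fun w => Prog.ret (some (v, w))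
      else Prog.ret none

theorem tryEdge_eq (n θ : ℕ) : (tryEdge n θ : GraphProg V (Option (V × V))) =
    (Prog.sample (uniformBelow n)).bind fun i => (askVertex i).bind fun o =>
      o.elim (Prog.ret none) fun u => (Prog.sample (uniformBelow θ)).bind fun j =>
        (askDegree u).bind fun d =>
          if d > θ ∨ d ≤ j then Prog.ret none
          else (askNeighbor u j).bind fun o' =>
            o'.elim (Prog.ret none) fun v => extendEdge θ u v := by
  refine congrArg (Prog.bind _) (funext fun i => congrArg (Prog.bind _) (funext fun o => ?_))
  cases o with
  | none => rfl
  | some u =>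
    refine congrArg (Prog.bind _) (funext fun j => congrArg (Prog.bind _) (funext fun d => ?_))
    refine if_congr Iff.rfl rfl (congrArg (Prog.bind _) (funext fun o' => ?_))
    cases o' with
    | none => rfl
    | some v =>
      refine congrArg (Prog.bind _) (funext fun B => if_congr Iff.rfl rfl
        (congrArg (Prog.bind _) (funext fun d' => if_congr Iff.rfl
          (congrArg (Prog.bind _) (funext fun o'' => ?_)) rfl)))
      cases o'' <;> rfl

theorem lightNeighborTrial_eq (θ : ℕ) (v : V) : lightNeighborTrial θ v =
    (randomNeighbor v).bind fun o => o.elim (Prog.ret false) fun w =>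
      (askDegree w).bind fun d => Prog.ret (decide (d ≤ θ)) := by
  refine congrArg (Prog.bind _) (funext fun o => ?_)
  cases o <;> rfl

/-- The part of a round that decides whether to keep the edge that an attempt has returned. -/
noncomputable def keepEdge (F : CoinProg) (θ : ℕ) (x : V × V) : GraphProg V (Option (V × V)) :=
  (askDegree x.1).bind fun d =>
    if d ≤ θ then Prog.ret (some x)
    else (Prog.substQuery (fun _ => lightNeighborTrial θ x.1) F).bind fun Y =>
      if Y = true then Prog.ret (some x) else Prog.ret none

theorem edgeRound_eq (F : CoinProg) (n θ : ℕ) : (edgeRound F n θ : GraphProg V _) =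
    (tryEdge n θ).bind fun o => o.elim (Prog.ret none) fun x => keepEdge F θ x := by
  refine congrArg (Prog.bind _) (funext fun o => ?_)
  cases o <;> rfl

variable [Fintype V] {G : SimpleGraph V} [DecidableRel G.Adj] (L : IndexedAccess G)

theorem ev_ask_oracle (c : ℝ≥0∞) (q : GraphQuery V) (f : q.Ans → ℝ≥0∞) :
    Prog.ev L.oracle c (Prog.ask q) f = c + f (L.answer q) := by
  rw [Prog.ev_ask, IndexedAccess.oracle, tsum_eq_single (L.answer q)]
  · simp
  · intro r hr
    simp [hr]

theorem ev_askDegree (c : ℝ≥0∞) (v : V) (f : ℕ → ℝ≥0∞) :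
    Prog.ev L.oracle c (askDegree v) f = c + f (G.degree v) :=
  ev_ask_oracle L c (.degree v) f

theorem ev_askVertex (c : ℝ≥0∞) (i : Fin (Fintype.card V)) (f : Option V → ℝ≥0∞) :
    Prog.ev L.oracle c (askVertex i) f = c + f (some (L.vertexLabel i)) := by
  refine (ev_ask_oracle L c (.vertex i) f).trans ?_
  simp [IndexedAccess.answer]

theorem ev_askNeighbor (c : ℝ≥0∞) (v : V) (j : Fin (G.degree v)) (f : Option V → ℝ≥0∞) :
    Prog.ev L.oracle c (askNeighbor v j) f = c + f (some (L.neighborLabel v j)) := by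
  refine (ev_ask_oracle L c (.neighbor v j) f).trans ?_
  simp [IndexedAccess.answer]

/-- Here and in `sum_ev_askNeighbor` the arbitrary labellings disappear: they are bijections, and
all labels are summed over. -/
theorem sum_ev_askVertex (c : ℝ≥0∞) (f : Option V → ℝ≥0∞) :
    ∑ i ∈ Finset.range (Fintype.card V), Prog.ev L.oracle c (askVertex i) f =
      ∑ u, (c + f (some u)) := by
  rw [Finset.sum_range, ← Equiv.sum_comp L.vertexLabel]
  simp only [ev_askVertex]

theorem sum_ev_askNeighbor (c : ℝ≥0∞) (v : V) (f : Option V → ℝ≥0∞) :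
    ∑ j ∈ Finset.range (G.degree v), Prog.ev L.oracle c (askNeighbor v j) f =
      ∑ w ∈ G.neighborFinset v, (c + f (some w)) := by
  rw [Finset.sum_range, Finset.sum_subtype (G.neighborFinset v) (p := (· ∈ G.neighborSet v))
    (by simp), ← Equiv.sum_comp (L.neighborLabel v)]
  simp only [ev_askNeighbor]

theorem ev_randomNeighbor (c : ℝ≥0∞) {v : V} (hv : 0 < G.degree v) (f : Option V → ℝ≥0∞) :
    Prog.ev L.oracle c (randomNeighbor v) f =
      c + (G.degree v : ℝ≥0∞)⁻¹ * ∑ w ∈ G.neighborFinset v, (c + f (some w)) := by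
  rw [randomNeighbor_eq]
  simp only [Prog.ev_bind, Prog.ev_sample, ev_askDegree]
  rw [tsum_uniformBelow hv, sum_ev_askNeighbor]

/-- The fraction of the light vertices among the neighbors of `v`. -/
noncomputable def lightFraction (G : SimpleGraph V) [DecidableRel G.Adj] (θ : ℕ) (v : V) : NNReal :=
  ((G.neighborFinset v).filter fun w => G.degree w ≤ θ).card / G.degree v

theorem lightFraction_le_one (θ : ℕ) (v : V) : lightFraction G θ v ≤ 1 := by
  refine div_le_one_of_le₀ ?_ zero_le
  rw [← G.card_neighborFinset_eq_degree]
  exact_mod_cast Finset.card_filter_le _ _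

theorem coe_lightFraction (θ : ℕ) {v : V} (hv : 0 < G.degree v) :
    (lightFraction G θ v : ℝ≥0∞) = (G.degree v : ℝ≥0∞)⁻¹ *
      ((G.neighborFinset v).filter fun w => G.degree w ≤ θ).card := by
  rw [lightFraction, ENNReal.coe_div (by exact_mod_cast hv.ne'), mul_comm, ENNReal.div_eq_inv_mul,
    mul_comm]
  simp

theorem natCast_inv_mul_cancel {d : ℕ} (hd : 0 < d) : (d : ℝ≥0∞)⁻¹ * d = 1 :=
  ENNReal.inv_mul_cancel (by exact_mod_cast hd.ne') (ENNReal.natCast_ne_top d)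

theorem one_sub_lightFraction (θ : ℕ) {v : V} (hv : 0 < G.degree v) :
    1 - (lightFraction G θ v : ℝ≥0∞) = (G.degree v : ℝ≥0∞)⁻¹ *
      ((G.neighborFinset v).filter fun w => ¬ G.degree w ≤ θ).card := by
  refine ENNReal.sub_eq_of_eq_add ENNReal.coe_ne_top ?_
  rw [coe_lightFraction θ hv, ← mul_add, ← Nat.cast_add, add_comm,
    Finset.card_filter_add_card_filter_not, G.card_neighborFinset_eq_degree,
    natCast_inv_mul_cancel hv]

/-- A trial always makes three queries (two degrees and a neighbor), so it acts as one flip of a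
coin at price `3 * c`, the form needed for `Prog.ev_substQuery`. -/
theorem ev_lightNeighborTrial (c : ℝ≥0∞) (θ : ℕ) {v : V} (hv : 0 < G.degree v)
    (f : Bool → ℝ≥0∞) :
    Prog.ev L.oracle c (lightNeighborTrial θ v) f =
      3 * c + ∑' b, coin (lightFraction G θ v) (lightFraction_le_one θ v) () b * f b := by
  have hd := natCast_inv_mul_cancel hv
  rw [coin, tsum_bern, one_sub_lightFraction θ hv, coe_lightFraction θ hv,
    lightNeighborTrial_eq, Prog.ev_bind, ev_randomNeighbor L c hv]
  simp only [Option.elim, Prog.ev_bind, ev_askDegree, Prog.ev_ret]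
  have hs : ∑ w ∈ G.neighborFinset v, f (decide (G.degree w ≤ θ)) =
      ((G.neighborFinset v).filter fun w => G.degree w ≤ θ).card * f true +
      ((G.neighborFinset v).filter fun w => ¬ G.degree w ≤ θ).card * f false := by
    rw [← Finset.sum_filter_add_sum_filter_not _ (fun w => G.degree w ≤ θ)]
    congr 1
    · rw [Finset.sum_congr rfl (g := fun _ => f true)]
      · simp
      · intro w hw
        rw [decide_eq_true (Finset.mem_filter.mp hw).2]
    · rw [Finset.sum_congr rfl (g := fun _ => f false)]
      · simp
      · intro w hw
        rw [decide_eq_false (Finset.mem_filter.mp hw).2]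
  rw [Finset.sum_add_distrib, Finset.sum_add_distrib, hs, Finset.sum_const,
    G.card_neighborFinset_eq_degree, nsmul_eq_mul, mul_add, mul_add, mul_add, ← mul_assoc, hd,
    ← mul_assoc, ← mul_assoc]
  ring

/-- The h heavy neighbors have degree at least θ + 1 each, so h(θ + 1) ≤ 2m. Since 6m ≤ θ², this
forces 3h ≤ θ < d(v). -/
theorem two_thirds_le_lightFraction {θ : ℕ} (hθ : 6 * G.edgeFinset.card ≤ θ ^ 2) {v : V}
    (hv : θ < G.degree v) : 2 / 3 ≤ lightFraction G θ v := by
  classical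
  set l := ((G.neighborFinset v).filter fun w => G.degree w ≤ θ).card with hl
  set h := ((G.neighborFinset v).filter fun w => ¬ G.degree w ≤ θ).card with hh
  have hsum : l + h = G.degree v := by
    rw [hl, hh, Finset.card_filter_add_card_filter_not, G.card_neighborFinset_eq_degree]
  have h1 : h * (θ + 1) ≤ 2 * G.edgeFinset.card := by
    rw [← G.sum_degrees_eq_twice_card_edges]
    calc h * (θ + 1) = ∑ w ∈ (G.neighborFinset v).filter fun w => ¬ G.degree w ≤ θ, (θ + 1) := by
          rw [Finset.sum_const, smul_eq_mul]
      _ ≤ ∑ w ∈ (G.neighborFinset v).filter fun w => ¬ G.degree w ≤ θ, G.degree w :=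
          Finset.sum_le_sum fun w hw => not_le.mp (Finset.mem_filter.mp hw).2
      _ ≤ ∑ w, G.degree w := Finset.sum_le_sum_of_subset (Finset.subset_univ _)
  have h2 : 3 * h ≤ θ := by
    by_contra hcon
    nlinarith
  have h3 : 2 * G.degree v ≤ 3 * l := by omega
  rw [lightFraction, div_le_div_iff₀ (by norm_num) (by exact_mod_cast (Nat.zero_le θ).trans_lt hv),
    ← hl]
  rw [mul_comm (l : NNReal)]
  exact_mod_cast h3

theorem coe_one_third : ((1 / 3 : NNReal) : ℝ≥0∞) = 3⁻¹ := by
  rw [one_div, ENNReal.coe_inv (by norm_num)]; rfl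

theorem one_sub_inv_three : (1 : ℝ≥0∞) - 3⁻¹ = 2 * 3⁻¹ := by
  refine ENNReal.sub_eq_of_eq_add (by simp) ?_
  have : (2 : ℝ≥0∞) * 3⁻¹ + 3⁻¹ = 3 * 3⁻¹ := by ring
  rw [this, ENNReal.mul_inv_cancel (by norm_num) (by norm_num)]

theorem ev_extendEdge {θ : ℕ} {u v : V} (hv : 0 < G.degree v)
    (g : Option (V × V) → ℝ≥0∞) (hg : g none = 0) :
    Prog.ev L.oracle 0 (extendEdge θ u v) g = 3⁻¹ * g (some (u, v)) + 2 * 3⁻¹ *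
      if G.degree v ≤ θ then 0
      else (G.degree v : ℝ≥0∞)⁻¹ * ∑ w ∈ G.neighborFinset v, g (some (v, w)) := by
  rw [extendEdge, Prog.ev_bind, Prog.ev_sample, tsum_bern, coe_one_third, one_sub_inv_three]
  simp only [if_true, Bool.false_eq_true, if_false, Prog.ev_ret, Prog.ev_bind, ev_askDegree,
    zero_add]
  congr 2
  by_cases h : G.degree v ≤ θ
  · rw [if_neg (not_lt.mpr h), if_pos h, Prog.ev_ret, hg]
  · rw [if_pos (not_le.mp h), if_neg h, Prog.ev_bind, ev_randomNeighbor L 0 hv]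
    simp only [zero_add, Option.elim, Prog.ev_ret]

theorem ev_tryEdge [Nonempty V] {θ : ℕ} (hθ : 0 < θ) (g : Option (V × V) → ℝ≥0∞)
    (hg : g none = 0) :
    Prog.ev L.oracle 0 (tryEdge (Fintype.card V) θ) g =
      (Fintype.card V : ℝ≥0∞)⁻¹ * ∑ u, if G.degree u ≤ θ then
        (θ : ℝ≥0∞)⁻¹ * ∑ v ∈ G.neighborFinset u, Prog.ev L.oracle 0 (extendEdge θ u v) g
      else 0 := by
  rw [tryEdge_eq, Prog.ev_bind, Prog.ev_sample, tsum_uniformBelow Fintype.card_pos]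
  simp only [Prog.ev_bind]
  rw [sum_ev_askVertex]
  congr 1
  refine Finset.sum_congr rfl fun u _ => ?_
  simp only [Option.elim, zero_add, Prog.ev_bind, Prog.ev_sample, ev_askDegree]
  rw [tsum_uniformBelow hθ]
  split_ifs with h
  · congr 1
    have hs := sum_ev_askNeighbor L 0 u fun o =>
      Prog.ev L.oracle 0 (o.elim (Prog.ret none) fun v => extendEdge θ u v) g
    simp only [zero_add, Option.elim] at hs
    rw [← hs]
    -- Labels from d(u) to θ - 1 make the attempt fail and contribute 0, so a light vertex gives
    -- each neighbor the weight 1/θ regardless of its degree.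
    rw [← Finset.sum_subset (Finset.range_subset_range.mpr h)]
    · refine Finset.sum_congr rfl fun j hj => ?_
      rw [if_neg (by rw [Finset.mem_range] at hj; omega), Prog.ev_bind]
    · intro j _ hj
      rw [if_pos (by rw [Finset.mem_range] at hj; omega), Prog.ev_ret, hg]
  · rw [Finset.sum_eq_zero, mul_zero]
    intro j _
    rw [if_pos (Or.inl (not_le.mp h)), Prog.ev_ret, hg]

end Graph

/-! ### One round: halting, cost and output distribution -/

section Graph

variable {V : Type} [Fintype V] {G : SimpleGraph V} [DecidableRel G.Adj] (L : IndexedAccess G)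

theorem ev_substQuery_lightNeighborTrial (F : CoinProg) (c : ℝ≥0∞) (θ : ℕ) {v : V}
    (hv : 0 < G.degree v) (f : Bool → ℝ≥0∞) :
    Prog.ev L.oracle c (F.substQuery fun _ => lightNeighborTrial θ v) f =
      Prog.ev (coin (lightFraction G θ v) (lightFraction_le_one θ v)) (3 * c) F f :=
  Prog.ev_substQuery _ L.oracle (fun _ => ev_lightNeighborTrial L c θ hv) F f

variable {F : CoinProg} {θ : ℕ}

/-- The probability that an edge at `v` is kept. -/
noncomputable def keepProb (G : SimpleGraph V) [DecidableRel G.Adj] (θ : ℕ) (v : V) : ℝ≥0∞ :=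
  if G.degree v ≤ θ then 1 else ENNReal.ofReal (1 / (2 * (lightFraction G θ v : ℝ)))

theorem IsInvTwoFactory.halts (hF : IsInvTwoFactory F) {p : NNReal} (hp : p ≤ 1) (hp' : 2 / 3 ≤ p) :
    Prog.Halts (coin p hp) F := by
  have h : (2 / 3 : ℝ) ≤ p := by exact_mod_cast hp'
  rw [Prog.Halts, Prog.ev_bool, (hF.1 p hp hp').1, (hF.1 p hp hp').2, mul_one, mul_one,
    ← ENNReal.ofReal_add (by positivity), add_sub_cancel, ENNReal.ofReal_one]
  rw [sub_nonneg, div_le_one (by positivity)]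
  linarith

theorem ev_keepEdge (hF : IsInvTwoFactory F) (hθ : 6 * G.edgeFinset.card ≤ θ ^ 2) (x : V × V)
    (f : Option (V × V) → ℝ≥0∞) (hf : f none = 0) :
    Prog.ev L.oracle 0 (keepEdge F θ x) f = keepProb G θ x.1 * f (some x) := by
  rw [keepEdge, Prog.ev_bind, ev_askDegree, zero_add, keepProb]
  split_ifs with h
  · rw [Prog.ev_ret, one_mul]
  · have hp := two_thirds_le_lightFraction hθ (not_le.mp h)
    rw [Prog.ev_bind, ev_substQuery_lightNeighborTrial L F 0 θ (by omega), mul_zero, Prog.ev_bool,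
      (hF.1 _ _ hp).1]
    simp [Prog.ev_ret, hf]

theorem halts_keepEdge (hF : IsInvTwoFactory F) (hθ : 6 * G.edgeFinset.card ≤ θ ^ 2) (x : V × V) :
    Prog.Halts L.oracle (keepEdge F θ x) := by
  rw [Prog.Halts, keepEdge, Prog.ev_bind, ev_askDegree, zero_add]
  split_ifs with h
  · rw [Prog.ev_ret]
  · refine Prog.Halts.bind ?_ fun Y => ?_
    · rw [Prog.Halts, ev_substQuery_lightNeighborTrial L F 0 θ (by omega), mul_zero]
      exact hF.halts _ (two_thirds_le_lightFraction hθ (not_le.mp h))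
    · split_ifs <;> exact Prog.Halts.ret _

theorem expectedQueries_keepEdge_le {K : NNReal}
    (hK : ∀ (p : NNReal) (hp : p ≤ 1), 2 / 3 ≤ p → F.expectedQueries (coin p hp) ≤ K)
    (hθ : 6 * G.edgeFinset.card ≤ θ ^ 2) (x : V × V) :
    (keepEdge F θ x).expectedQueries L.oracle ≤ 1 + 3 * K := by
  rw [Prog.expectedQueries, keepEdge, Prog.ev_bind, ev_askDegree]
  refine add_le_add_right ?_ 1
  split_ifs with h
  · rw [Prog.ev_ret]; exact zero_le
  · have hsub : (F.substQuery fun _ => lightNeighborTrial θ x.1).expectedQueries L.oracle ≤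
        3 * K := by
      rw [Prog.expectedQueries, ev_substQuery_lightNeighborTrial L F 1 θ (by omega)]
      -- Each flip requested by the factory costs three graph queries.
      have := Prog.ev_mul (coin _ (lightFraction_le_one (G := G) θ x.1)) 3 1 F 0
      simp only [Pi.zero_apply, mul_zero] at this
      calc _ = _ := this
        _ ≤ _ := mul_le_mul_right (hK _ _ (two_thirds_le_lightFraction hθ (not_le.mp h))) 3
    refine (Prog.expectedQueries_bind_le L.oracle _ _ hsub (b := 0) fun Y => ?_).trans_eq
      (add_zero _)
    split_ifs <;> rw [Prog.expectedQueries_ret]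

theorem halts_randomNeighbor (v : V) : Prog.Halts L.oracle (randomNeighbor v) :=
  (Prog.Halts.ask _).bind fun _ => (Prog.Halts.sample _).bind fun _ => Prog.Halts.ask _

theorem expectedQueries_randomNeighbor_le (v : V) :
    (randomNeighbor v).expectedQueries L.oracle ≤ 2 := by
  rw [randomNeighbor_eq]
  refine (Prog.expectedQueries_bind_le L.oracle (askDegree v) _ (Prog.expectedQueries_ask _ _).le
    (b := 1) fun d => ?_).trans_eq (by norm_num)
  refine (Prog.expectedQueries_bind_le L.oracle _ _ (Prog.expectedQueries_sample _ _).le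
    (b := 1) fun j => ?_).trans_eq (zero_add _)
  exact (Prog.expectedQueries_ask L.oracle (GraphQuery.neighbor v j)).le

theorem halts_extendEdge (u v : V) : Prog.Halts L.oracle (extendEdge θ u v) := by
  refine (Prog.Halts.sample _).bind fun B => ?_
  split_ifs
  · exact Prog.Halts.ret _
  · refine Prog.Halts.bind (Prog.Halts.ask _) fun d => ?_
    split_ifs
    · refine (halts_randomNeighbor L v).bind fun o => ?_
      cases o <;> exact Prog.Halts.ret _
    · exact Prog.Halts.ret _

theorem expectedQueries_extendEdge_le (u v : V) :
    (extendEdge θ u v).expectedQueries L.oracle ≤ 3 := by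
  refine (Prog.expectedQueries_bind_le L.oracle _ _ (Prog.expectedQueries_sample _ _).le
    (b := 3) fun B => ?_).trans_eq (zero_add _)
  split_ifs
  · rw [Prog.expectedQueries_ret]; exact zero_le
  · refine (Prog.expectedQueries_bind_le L.oracle _ _ (Prog.expectedQueries_ask _ _).le
      (b := 2) fun d => ?_).trans_eq (by norm_num)
    split_ifs
    · refine (Prog.expectedQueries_bind_le L.oracle _ _ (expectedQueries_randomNeighbor_le L v)
        (b := 0) fun o => ?_).trans_eq (add_zero _)
      cases o <;> exact (Prog.expectedQueries_ret _ _).le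
    · rw [Prog.expectedQueries_ret]; exact zero_le

theorem halts_tryEdge (n : ℕ) : Prog.Halts L.oracle (tryEdge n θ) := by
  rw [tryEdge_eq]
  refine (Prog.Halts.sample _).bind fun i => Prog.Halts.bind (Prog.Halts.ask _) fun o => ?_
  cases o with
  | none => exact Prog.Halts.ret _
  | some u =>
    refine (Prog.Halts.sample _).bind fun j => Prog.Halts.bind (Prog.Halts.ask _) fun d => ?_
    split_ifs
    · exact Prog.Halts.ret _
    · refine Prog.Halts.bind (Prog.Halts.ask _) fun o => ?_
      cases o with
      | none => exact Prog.Halts.ret _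
      | some v => exact halts_extendEdge L u v

/-- Six queries in the worst case: a vertex, its degree, a neighbor, the degree of that neighbor,
and two for a random neighbor. -/
theorem expectedQueries_tryEdge_le (n : ℕ) : (tryEdge n θ).expectedQueries L.oracle ≤ 6 := by
  rw [tryEdge_eq]
  refine (Prog.expectedQueries_bind_le L.oracle _ _ (Prog.expectedQueries_sample _ _).le
    fun i => Prog.expectedQueries_bind_le L.oracle _ _ (Prog.expectedQueries_ask _ _).le
      (b := 5) fun o => ?_).trans_eq (by norm_num)
  cases o with
  | none => exact (Prog.expectedQueries_ret _ _).trans_le zero_le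
  | some u =>
    refine (Prog.expectedQueries_bind_le L.oracle _ _ (Prog.expectedQueries_sample _ _).le
      fun j => Prog.expectedQueries_bind_le L.oracle _ _ (Prog.expectedQueries_ask _ _).le
        (b := 4) fun d => ?_).trans_eq (by norm_num)
    split_ifs
    · exact (Prog.expectedQueries_ret _ _).trans_le zero_le
    · refine (Prog.expectedQueries_bind_le L.oracle _ _ (Prog.expectedQueries_ask _ _).le
        (b := 3) fun o => ?_).trans_eq (by norm_num)
      cases o with
      | none => exact (Prog.expectedQueries_ret _ _).trans_le zero_le
      | some v => exact expectedQueries_extendEdge_le L u v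

theorem halts_edgeRound (hF : IsInvTwoFactory F) (hθ : 6 * G.edgeFinset.card ≤ θ ^ 2) (n : ℕ) :
    Prog.Halts L.oracle (edgeRound F n θ) := by
  rw [edgeRound_eq]
  refine (halts_tryEdge L n).bind fun o => ?_
  cases o with
  | none => exact Prog.Halts.ret _
  | some x => exact halts_keepEdge L hF hθ x

theorem expectedQueries_edgeRound_le {K : NNReal}
    (hK : ∀ (p : NNReal) (hp : p ≤ 1), 2 / 3 ≤ p → F.expectedQueries (coin p hp) ≤ K)
    (hθ : 6 * G.edgeFinset.card ≤ θ ^ 2) (n : ℕ) :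
    (edgeRound F n θ).expectedQueries L.oracle ≤ 6 + (1 + 3 * K) := by
  rw [edgeRound_eq]
  refine Prog.expectedQueries_bind_le L.oracle _ _ (expectedQueries_tryEdge_le L n) fun o => ?_
  cases o with
  | none => exact (Prog.expectedQueries_ret _ _).trans_le zero_le
  | some x => exact expectedQueries_keepEdge_le L hK hθ x

theorem lightFraction_mul_keepProb (hθ : 6 * G.edgeFinset.card ≤ θ ^ 2) {v : V}
    (hv : θ < G.degree v) : (lightFraction G θ v : ℝ≥0∞) * (2 * keepProb G θ v) = 1 := by
  have hp := two_thirds_le_lightFraction hθ hv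
  have hpos : (0 : ℝ) < lightFraction G θ v := by
    have : (2 / 3 : ℝ) ≤ lightFraction G θ v := by exact_mod_cast hp
    linarith
  rw [keepProb, if_neg (not_le.mpr hv), ← ENNReal.ofReal_coe_nnreal,
    show (2 : ℝ≥0∞) = ENNReal.ofReal 2 by simp, ← ENNReal.ofReal_mul (by norm_num),
    ← ENNReal.ofReal_mul hpos.le, ← ENNReal.ofReal_one]
  congr 1
  field_simp

/-- In one round, all pairs of adjacent vertices are returned with the same probability. -/
theorem ev_edgeRound [Nonempty V] (hF : IsInvTwoFactory F) (h0 : 0 < θ)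
    (hθ : 6 * G.edgeFinset.card ≤ θ ^ 2) (f : Option (V × V) → ℝ≥0∞) (hf : f none = 0) :
    Prog.ev L.oracle 0 (edgeRound F (Fintype.card V) θ) f =
      (Fintype.card V : ℝ≥0∞)⁻¹ * (θ : ℝ≥0∞)⁻¹ * 3⁻¹ *
        ∑ u, ∑ v ∈ G.neighborFinset u, f (some (u, v)) := by
  have hpos : ∀ u, ∀ v ∈ G.neighborFinset u, 0 < G.degree v := fun u v h =>
    (G.degree_pos_iff_exists_adj v).mpr ⟨u, ((G.mem_neighborFinset u v).mp h).symm⟩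
  rw [edgeRound_eq, Prog.ev_bind, ev_tryEdge L h0 _ (by simpa [Prog.ev_ret] using hf)]
  set S : V → ℝ≥0∞ := fun v => ∑ w ∈ G.neighborFinset v, f (some (v, w)) with hS
  -- The contribution of the branch B = 0 once a heavy `v` is reached. It does not depend on the
  -- light vertex `u` that led there.
  set H : V → ℝ≥0∞ := fun v => if G.degree v ≤ θ then 0
    else 2 * 3⁻¹ * ((G.degree v : ℝ≥0∞)⁻¹ * (keepProb G θ v * S v)) with hH
  have h1 : ∀ u, G.degree u ≤ θ → ∀ v ∈ G.neighborFinset u,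
      Prog.ev L.oracle 0 (extendEdge θ u v) (fun a => Prog.ev L.oracle 0
        (a.elim (Prog.ret none) fun x => keepEdge F θ x) f) = 3⁻¹ * f (some (u, v)) + H v := by
    intro u hu v hv
    rw [ev_extendEdge L (hpos u v hv) _ (by simpa [Prog.ev_ret] using hf)]
    simp only [Option.elim, ev_keepEdge L hF hθ _ f hf]
    rw [keepProb, if_pos hu, one_mul, hH]
    simp only [← Finset.mul_sum, mul_ite, mul_zero, hS]
  -- Summing over the light neighbors of a heavy `v` produces the light fraction, which the factory
  -- cancels; what remains is the weight 1/3 that light vertices receive from B = 1.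
  have h2 : ∀ v, ∑ u ∈ G.neighborFinset v, (if G.degree u ≤ θ then H v else 0) =
      if G.degree v ≤ θ then 0 else 3⁻¹ * S v := by
    intro v
    rw [← Finset.sum_filter, Finset.sum_const, nsmul_eq_mul]
    by_cases hv : G.degree v ≤ θ
    · simp [hH, hv]
    · have hk := lightFraction_mul_keepProb hθ (not_le.mp hv)
      rw [coe_lightFraction θ (by omega)] at hk
      simp only [hH, if_neg hv]
      calc _ = ((G.degree v : ℝ≥0∞)⁻¹ *
            ((G.neighborFinset v).filter fun w => G.degree w ≤ θ).card *
            (2 * keepProb G θ v)) * (3⁻¹ * S v) := by ring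
        _ = _ := by rw [hk, one_mul]
  have h3 : ∑ u, ∑ v ∈ G.neighborFinset u, (if G.degree u ≤ θ then H v else 0) =
      ∑ v, if G.degree v ≤ θ then 0 else 3⁻¹ * S v := by
    -- Count by the endpoint `v` instead of the starting vertex `u`; adjacency is symmetric.
    rw [Finset.sum_comm' (t' := Finset.univ) (s' := fun v => G.neighborFinset v)
      (by simp [SimpleGraph.adj_comm])]
    exact Finset.sum_congr rfl fun v _ => h2 v
  have h4 : ∀ u, (if G.degree u ≤ θ then (θ : ℝ≥0∞)⁻¹ * ∑ v ∈ G.neighborFinset u,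
      Prog.ev L.oracle 0 (extendEdge θ u v) (fun a => Prog.ev L.oracle 0
        (a.elim (Prog.ret none) fun x => keepEdge F θ x) f) else 0) =
      (θ : ℝ≥0∞)⁻¹ * ((if G.degree u ≤ θ then 3⁻¹ * S u else 0) +
        ∑ v ∈ G.neighborFinset u, if G.degree u ≤ θ then H v else 0) := by
    intro u
    split_ifs with hu
    · rw [Finset.sum_congr rfl (h1 u hu), Finset.sum_add_distrib, ← Finset.mul_sum]
    · simp
  simp only [h4]
  rw [← Finset.mul_sum, Finset.sum_add_distrib, h3, ← Finset.sum_add_distrib, mul_assoc, mul_assoc,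
    Finset.mul_sum (a := (3 : ℝ≥0∞)⁻¹)]
  congr 2
  refine Finset.sum_congr rfl fun u _ => ?_
  split_ifs <;> simp [hS]

end Graph

/-! ### The repeated algorithm -/

section Graph

variable {V : Type} [Fintype V] {G : SimpleGraph V} [DecidableRel G.Adj] (L : IndexedAccess G)
  {F : CoinProg} {θ : ℕ}

theorem sum_neighborFinset_one :
    ∑ u : V, ∑ _v ∈ G.neighborFinset u, (1 : ℝ≥0∞) = 2 * G.edgeFinset.card := by
  classical
  simp only [Finset.sum_const, nsmul_eq_mul, mul_one, G.card_neighborFinset_eq_degree]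
  exact_mod_cast G.sum_degrees_eq_twice_card_edges

theorem sum_neighborFinset_edge [DecidableEq V] {e : Sym2 V} (he : e ∈ G.edgeFinset) :
    ∑ u, ∑ v ∈ G.neighborFinset u,
      ({x : V × V | s(x.1, x.2) = e} : Set (V × V)).indicator (1 : V × V → ℝ≥0∞) (u, v) = 2 := by
  induction e with | h a b => ?_
  have hab : G.Adj a b := by simpa using he
  have hne := hab.ne
  have : ∀ u, ∑ v ∈ G.neighborFinset u,
      ({x : V × V | s(x.1, x.2) = s(a, b)} : Set (V × V)).indicator (1 : V × V → ℝ≥0∞) (u, v) =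
      (if u = a then 1 else 0) + if u = b then 1 else 0 := by
    intro u
    have h : ∀ v, ({x : V × V | s(x.1, x.2) = s(a, b)} : Set (V × V)).indicator
        (1 : V × V → ℝ≥0∞) (u, v) =
        (if v = b then if u = a then 1 else 0 else 0) +
          if v = a then if u = b then 1 else 0 else 0 := by
      intro v
      rw [Set.indicator_apply]
      simp only [Set.mem_ofPred_eq, Sym2.eq_iff, Pi.one_apply]
      by_cases h1 : v = b <;> by_cases h2 : v = a <;> simp_all
    simp only [h, Finset.sum_add_distrib, Finset.sum_ite_eq', SimpleGraph.mem_neighborFinset]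
    congr 1
    · by_cases hu : u = a
      · subst hu; simp [hab]
      · simp [hu]
    · by_cases hu : u = b
      · subst hu; simp [hab.symm]
      · simp [hu]
  simp only [this, Finset.sum_add_distrib, Finset.sum_ite_eq', Finset.mem_univ, if_true]
  norm_num

theorem sum_neighborFinset_pair [DecidableEq V] (a b : V) :
    ∑ u, ∑ v ∈ G.neighborFinset u,
      ({(a, b)} : Set (V × V)).indicator (1 : V × V → ℝ≥0∞) (u, v) =
        if G.Adj a b then 1 else 0 := by
  have h : ∀ u v, ({(a, b)} : Set (V × V)).indicator (1 : V × V → ℝ≥0∞) (u, v) =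
      if v = b then if u = a then 1 else 0 else 0 := by
    intro u v
    rw [Set.indicator_apply]
    simp only [Set.mem_singleton_iff, Prod.mk.injEq, Pi.one_apply]
    grind
  simp only [h, Finset.sum_ite_eq', SimpleGraph.mem_neighborFinset]
  rw [Finset.sum_eq_single a]
  · simp
  · intro u _ hu
    simp [hu]
  · simp

/-- The probability with which a round returns a given pair of adjacent vertices. -/
noncomputable def pairProb (n θ : ℕ) : ℝ≥0∞ := (n : ℝ≥0∞)⁻¹ * (θ : ℝ≥0∞)⁻¹ * 3⁻¹

theorem pairProb_ne_zero (n θ : ℕ) : pairProb n θ ≠ 0 := by simp [pairProb]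

theorem pairProb_ne_top {n θ : ℕ} (hn : 0 < n) (hθ : 0 < θ) : pairProb n θ ≠ ∞ := by
  simp [pairProb, ENNReal.mul_eq_top, hn.ne', hθ.ne']

/-- A round halts almost surely and gives each of the 2m ordered adjacent pairs the same
probability. -/
theorem edgeRound_fail_add [Nonempty V] (hF : IsInvTwoFactory F) (h0 : 0 < θ)
    (hθ : 6 * G.edgeFinset.card ≤ θ ^ 2) :
    Prog.ev L.oracle 0 (edgeRound F (Fintype.card V) θ) (fun r => r.elim 1 fun _ => 0) +
      pairProb (Fintype.card V) θ * (2 * G.edgeFinset.card) = 1 := by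
  have h : Prog.ev L.oracle 0 (edgeRound F (Fintype.card V) θ) (fun r => r.elim 0 fun _ => 1) =
      pairProb (Fintype.card V) θ * (2 * G.edgeFinset.card) := by
    rw [← sum_neighborFinset_one]
    exact ev_edgeRound L hF h0 hθ _ rfl
  rw [← h, ← Prog.ev_add]
  refine Eq.trans (congrArg _ (funext fun r => ?_)) (halts_edgeRound L hF hθ (Fintype.card V))
  cases r <;> simp

/-- The common factor `pairProb` cancels on conditioning on success, so neither n nor the threshold
affects the output. -/
theorem prob_sampleEdge [Nonempty V] (hF : IsInvTwoFactory F) {mt : ℝ} (h0 : 0 < ⌈√(6 * mt)⌉₊)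
    (hθ : 6 * G.edgeFinset.card ≤ ⌈√(6 * mt)⌉₊ ^ 2) (hm : 0 < G.edgeFinset.card)
    (E : Set (V × V))
    (hE : ∑ u, ∑ v ∈ G.neighborFinset u, E.indicator (1 : V × V → ℝ≥0∞) (u, v) ≠ ∞) :
    (sampleEdge F (Fintype.card V) mt).prob L.oracle E =
      (∑ u, ∑ v ∈ G.neighborFinset u, E.indicator (1 : V × V → ℝ≥0∞) (u, v)) /
        (2 * G.edgeFinset.card) := by
  have hα := pairProb_ne_zero (Fintype.card V) ⌈√(6 * mt)⌉₊
  have hα' := pairProb_ne_top (Fintype.card_pos (α := V)) h0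
  have hT : Prog.ev L.oracle 0 (edgeRound F (Fintype.card V) ⌈√(6 * mt)⌉₊)
      (fun r => r.elim 0 (E.indicator 1)) = pairProb (Fintype.card V) ⌈√(6 * mt)⌉₊ *
        ∑ u, ∑ v ∈ G.neighborFinset u, E.indicator (1 : V × V → ℝ≥0∞) (u, v) :=
    ev_edgeRound L hF h0 hθ _ rfl
  rw [Prog.prob, sampleEdge, Prog.ev_repeatUntil L.oracle 0 _ _ (edgeRound_fail_add L hF h0 hθ)
    (mul_ne_zero hα (mul_ne_zero two_ne_zero (by exact_mod_cast hm.ne')))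
    (by rw [hT]; exact ENNReal.mul_ne_top hα' hE), hT, ENNReal.mul_div_mul_left _ _ hα hα']

theorem expectedQueries_sampleEdge_le [Nonempty V] (hF : IsInvTwoFactory F) {K : NNReal}
    (hK : ∀ (p : NNReal) (hp : p ≤ 1), 2 / 3 ≤ p → F.expectedQueries (coin p hp) ≤ K)
    {mt : ℝ} (h0 : 0 < ⌈√(6 * mt)⌉₊) (hθ : 6 * G.edgeFinset.card ≤ ⌈√(6 * mt)⌉₊ ^ 2)
    (hm : 0 < G.edgeFinset.card) :
    (sampleEdge F (Fintype.card V) mt : GraphProg V (V × V)).expectedQueries L.oracle ≤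
      (6 + (1 + 3 * K)) /
        (pairProb (Fintype.card V) ⌈√(6 * mt)⌉₊ * (2 * G.edgeFinset.card)) := by
  refine (Prog.ev_repeatUntil_le L.oracle 1 _ _ (edgeRound_fail_add L hF h0 hθ)
    (mul_ne_zero (pairProb_ne_zero _ _)
      (mul_ne_zero two_ne_zero (by exact_mod_cast hm.ne')))).trans ?_
  refine ENNReal.div_le_div_right ?_ _
  refine le_trans (le_of_eq ?_) (expectedQueries_edgeRound_le L hK hθ (Fintype.card V))
  rw [Prog.expectedQueries]
  congr 1
  funext r
  cases r <;> rfl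

end Graph

/-! ### The threshold and the query bound -/

theorem threshold_bounds {m : ℕ} (hm : 0 < m) {a mt : ℝ} (h1 : (m : ℝ) ≤ mt) (h2 : mt ≤ a * m) :
    0 < ⌈√(6 * mt)⌉₊ ∧ 6 * m ≤ ⌈√(6 * mt)⌉₊ ^ 2 ∧
      (⌈√(6 * mt)⌉₊ : ℝ) ≤ (√(6 * a) + 1) * √m := by
  have hm1 : (1 : ℝ) ≤ m := by exact_mod_cast hm
  have hmt : 0 < mt := by linarith
  have ha : 0 ≤ a := by
    by_contra h
    nlinarith
  refine ⟨Nat.ceil_pos.mpr (Real.sqrt_pos.mpr (by linarith)), ?_, ?_⟩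
  · have h3 := Nat.le_ceil √(6 * mt)
    have h4 := Real.sq_sqrt (show 0 ≤ 6 * mt by linarith)
    have h5 : (6 * m : ℝ) ≤ (⌈√(6 * mt)⌉₊ : ℝ) ^ 2 := by
      have := pow_le_pow_left₀ (Real.sqrt_nonneg _) h3 2
      linarith
    exact_mod_cast h5
  · have h3 := (Nat.ceil_lt_add_one (Real.sqrt_nonneg (6 * mt))).le
    have h4 : √(6 * mt) ≤ √(6 * a) * √m := by
      rw [← Real.sqrt_mul (by linarith)]
      exact Real.sqrt_le_sqrt (by linarith)
    -- This absorbs the 1 lost to the ceiling into the multiple of √m.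
    have h5 : 1 ≤ √(m : ℝ) := Real.one_le_sqrt.mpr hm1
    linarith

theorem query_bound {n θ m : ℕ} {K : NNReal} {b : ℝ} (hn : 0 < n) (h0 : 0 < θ) (hm : 0 < m)
    (hθ : (θ : ℝ) ≤ b * √m) :
    (6 + (1 + 3 * (K : ℝ≥0∞))) / (pairProb n θ * (2 * m)) ≤
      ENNReal.ofReal ((7 + 3 * K) * (3 / 2) * b * (n / √m)) := by
  have hn' : (0 : ℝ) < n := by exact_mod_cast hn
  have h0' : (0 : ℝ) < θ := by exact_mod_cast h0
  have hm' : (0 : ℝ) < m := by exact_mod_cast hm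
  have e1 : pairProb n θ * (2 * m) = ENNReal.ofReal ((n : ℝ)⁻¹ * (θ : ℝ)⁻¹ * 3⁻¹ * (2 * m)) := by
    rw [ENNReal.ofReal_mul (by positivity), ENNReal.ofReal_mul (by positivity),
      ENNReal.ofReal_mul (by positivity), ENNReal.ofReal_mul (by positivity),
      ENNReal.ofReal_inv_of_pos hn', ENNReal.ofReal_inv_of_pos h0',
      ENNReal.ofReal_inv_of_pos (by norm_num)]
    simp [pairProb]
  have e2 : (6 + (1 + 3 * (K : ℝ≥0∞))) = ENNReal.ofReal (7 + 3 * K) := by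
    rw [ENNReal.ofReal_add (by norm_num) (by positivity), ENNReal.ofReal_mul (by norm_num),
      ENNReal.ofReal_coe_nnreal, ← add_assoc]
    norm_num
  rw [e1, e2, ← ENNReal.ofReal_div_of_pos (by positivity)]
  refine ENNReal.ofReal_le_ofReal ?_
  have hs : √(m : ℝ) * √m = m := Real.mul_self_sqrt hm'.le
  have hs0 : 0 < √(m : ℝ) := Real.sqrt_pos.mpr hm'
  have h1 : (7 + 3 * (K : ℝ)) / ((n : ℝ)⁻¹ * (θ : ℝ)⁻¹ * 3⁻¹ * (2 * m)) =
      (7 + 3 * K) * (3 / 2) * (n / m) * θ := by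
    field_simp
  have h2 : (7 + 3 * (K : ℝ)) * (3 / 2) * b * (n / √m) =
      (7 + 3 * K) * (3 / 2) * (n / m) * (b * √m) := by
    have : (n : ℝ) / √m = n / m * √m := by
      rw [div_mul_eq_mul_div, div_eq_div_iff hs0.ne' hm'.ne', mul_assoc, hs]
    rw [this]
    ring
  rw [h1, h2]
  exact mul_le_mul_of_nonneg_left hθ (by positivity)

theorem mainTheorem1 :
    (∃ F : CoinProg, IsInvTwoFactory F) ∧
    ∀ F : CoinProg, IsInvTwoFactory F → ∀ a : ℝ, ∃ C : ℝ,
      ∀ (V : Type) [Fintype V] [DecidableEq V] (G : SimpleGraph V) [DecidableRel G.Adj]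
        (L : IndexedAccess G) (mt : ℝ),
        0 < G.edgeFinset.card →
        (G.edgeFinset.card : ℝ) ≤ mt → mt ≤ a * (G.edgeFinset.card : ℝ) →
        (∀ e ∈ G.edgeFinset,
          (sampleEdge F (Fintype.card V) mt).prob L.oracle {x : V × V | s(x.1, x.2) = e} =
            1 / (G.edgeFinset.card : ENNReal)) ∧
        (∀ u v : V,
          (sampleEdge F (Fintype.card V) mt).prob L.oracle {(u, v)} =
            if G.Adj u v then 1 / (2 * (G.edgeFinset.card : ENNReal)) else 0) ∧
        (sampleEdge F (Fintype.card V) mt : GraphProg V (V × V)).expectedQueries L.oracle ≤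
          ENNReal.ofReal (C * ((Fintype.card V : ℝ) / √(G.edgeFinset.card : ℝ))) := by
  refine ⟨⟨_, InvTwoFactory.isInvTwoFactory⟩, fun F hF a => ?_⟩
  obtain ⟨K, hK⟩ := hF.2
  -- A round costs at most 7 + 3K expected queries, the inverse success probability is (3/2) nθ/m,
  -- and θ ≤ (√(6a) + 1)√m.
  refine ⟨(7 + 3 * K) * (3 / 2) * (√(6 * a) + 1), ?_⟩
  intro V _ _ G _ L mt hm h1 h2
  obtain ⟨h0, hθ, hb⟩ := threshold_bounds hm h1 h2
  obtain ⟨e, he⟩ := Finset.card_pos.mp hm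
  have : Nonempty V := ⟨e.out.1⟩
  refine ⟨fun e he => ?_, fun u v => ?_, ?_⟩
  · have hs := sum_neighborFinset_edge he
    rw [prob_sampleEdge L hF h0 hθ hm _ (by rw [hs]; norm_num), hs]
    simpa using ENNReal.mul_div_mul_left 1 (G.edgeFinset.card : ℝ≥0∞) two_ne_zero
      ENNReal.ofNat_ne_top
  · have hs := sum_neighborFinset_pair (G := G) u v
    rw [prob_sampleEdge L hF h0 hθ hm _ (by rw [hs]; split_ifs <;> norm_num), hs]
    split_ifs <;> simp
  · exact (expectedQueries_sampleEdge_le L hF hK h0 hθ hm).trans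
      (query_bound Fintype.card_pos h0 hm hb)
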